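/- Let $\mathcal A$ be a finite alphabet, and for a continuous map $F:\mathcal A^{\mathbb N}\to\mathcal A^{\mathbb N}$ and $\epsilon\in[0,1]$ let $F_\epsilon$ be the Markov kernel on $\mathcal A^{\mathbb N}$ (with its product $\sigma$-algebra) under which, given $x$, the cells $i\in\mathbb N$ of the new configuration are independent and cell $i$ equals $b\in\mathcal A$ with probability $(1-\epsilon)\mathbf 1_{b=F(x)_i}+\epsilon/|\mathcal A|$. It acts on probability measures by $F_\epsilon\mu=\int F_\epsilon(x,\cdot)\,d\mu(x)$. Let $\mathrm{Uni}(F)$ be the set of $\epsilon\in[0,1]$ for which $F_\epsilon$ has a unique invariant probability measure, and $\mathrm{Erg}(F)$ the set of $\epsilon\in[0,1]$ for which $F_\epsilon$ has a unique invariant probability measure $\pi$ and, moreover, $F_\epsilon^t\mu$ converges weakly to $\pi$ (that is, on every cylinder set) as $t\to\infty$, for every probability measure $\mu$. For $n\ge1$ and $i\in\mathbb N=\{0,1,2,\dots\}$ put $B_i=\{(2n+1)i+1,\dots,(2n+1)i+2n+1\}$, and let $\mathrm{maj}_{2n+1}:\{0,1\}^{\mathbb N}\to\{0,1\}^{\mathbb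 N}$ be the map for which $\mathrm{maj}_{2n+1}(y)_i$ is the majority symbol among the $y_j$, $j\in B_i$. Let $l_n=\inf\{\epsilon<1:\epsilon\in\mathrm{Uni}(\mathrm{maj}_{2n+1})\}$. For a sequence $I=(I_i)_{i\in\mathbb N}$ of subsets of $[0,1]$ and a sequence $E=(E_i)_{i\in\mathbb N}$ of non-empty finite subsets of $\mathbb N$, let $\mathrm{maj}_{2n+1}^{I,E}$ be the continuous map of $(\{0,1\}\times\{0,1\})^{\mathbb N}$ that sends $x=(y,z)$ to the configuration whose cell $i$ is $$\begin{cases}(0,0)&\text{if } \dfrac{2}{|E_i|}\displaystyle\sum_{j\in E_i}z_j\in I_i,\\[2mm] \bigl(\mathrm{maj}_{2n+1}(y)_i,\,0\bigr)&\text{otherwise.}\end{cases}$$ Then for every $n\ge1$ and every open subset $O$ of $[0,1]$ (for the topology of $[0,1]$) there are such families $I$ and $E$ with $$\mathrm{Uni}\bigl(\mathrm{maj}_{2n+1}^{I,E}\bigr)=\mathrm{Erg}\bigl(\mathrm{maj}_{2n+1}^{I,E}\bigr)=O\cup[l_n,1].$$ -/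

import Mathlib

open MeasureTheory ProbabilityTheory Filter Topology

noncomputable section

namespace NoisyMajority

/-! ### Computer perturbations of continuous maps of `A^ℕ` -/

/-- The law of one noisy cell: the correct symbol `a` is kept with probability `1 - ε`, and with
probability `ε` it is replaced by a symbol chosen uniformly in the alphabet. -/
def noisyCell {A : Type*} [Fintype A] [MeasurableSpace A]
    (ε : unitInterval) (a : A) : Measure A :=
  ENNReal.ofReal (1 - ε) • Measure.dirac a + ENNReal.ofReal ε • uniformOn Set.univ

instance isProbabilityMeasure_noisyCell {A : Type*} [Fintype A] [Nonempty A] [MeasurableSpace A]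
    [MeasurableSingletonClass A] (ε : unitInterval) (a : A) :
    IsProbabilityMeasure (noisyCell ε a) := by
  constructor
  simp only [noisyCell, Measure.add_apply, Measure.smul_apply, measure_univ, smul_eq_mul, mul_one]
  rw [← ENNReal.ofReal_add (by linarith [ε.2.2]) ε.2.1]
  simp

/-- The probability that a noisy cell shows `b` is `(1 - ε) 1_{b = a} + ε / |A|`. -/
theorem noisyCell_singleton {A : Type*} [Fintype A] [Nonempty A] [DecidableEq A]
    [MeasurableSpace A] [MeasurableSingletonClass A] (ε : unitInterval) (a b : A) :
    noisyCell ε a {b} =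
      ENNReal.ofReal ((1 - ε) * (if b = a then 1 else 0) + ε / Fintype.card A) := by
  have h1 : (0 : ℝ) ≤ 1 - ε := by linarith [ε.2.2]
  have hc : (0 : ℝ) < Fintype.card A := by exact_mod_cast Fintype.card_pos
  rw [ENNReal.ofReal_add (by split_ifs <;> simp [h1]) (div_nonneg ε.2.1 hc.le),
    ENNReal.ofReal_div_of_pos hc]
  simp only [noisyCell, Measure.add_apply, Measure.smul_apply, smul_eq_mul, uniformOn_univ,
    Measure.dirac_apply, Measure.count_singleton, ENNReal.ofReal_natCast]
  congr 1
  · by_cases h : b = a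
    · simp [h]
    · have : a ≠ b := fun h' => h h'.symm
      simp [h, this]
  · rw [one_div, div_eq_mul_inv]

/-- The computer perturbation `F_ε` of the continuous map `F : A^ℕ → A^ℕ`: given `x`, the cells of
the new configuration are independent, and cell `i` is a noisy copy of `F(x)_i`. -/
def perturbation {A : Type*} [Fintype A] [Nonempty A] [MeasurableSpace A]
    [MeasurableSingletonClass A] [TopologicalSpace A] [DiscreteTopology A]
    (F : C(ℕ → A, ℕ → A)) (ε : unitInterval) : Kernel (ℕ → A) (ℕ → A) where
  toFun x := Measure.infinitePi fun i => noisyCell ε (F x i)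
  measurable' := by
    have hB : BorelSpace A := ⟨by
      rw [borel_eq_top_of_discrete]
      exact top_le_iff.1 fun s _ => s.toFinite.measurableSet⟩
    refine Measurable.measure_of_isPiSystem_of_isProbabilityMeasure
      (generateFrom_squareCylinders (α := fun _ : ℕ => A)).symm
      (isPiSystem_squareCylinders (fun _ => MeasurableSpace.isPiSystem_measurableSet) (by simp)) ?_
    rintro _ ⟨s, t, ht, rfl⟩
    simp only [Set.mem_univ_pi, Set.mem_ofPred_eq] at ht
    simp only [Measure.infinitePi_pi (fun i => noisyCell ε _) (fun i _ => ht i)]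
    refine Finset.measurable_prod _ fun i _ => ?_
    have hF : Measurable fun x => F x i :=
      ((continuous_apply i).comp F.continuous).measurable
    exact (measurable_of_finite fun a : A => noisyCell ε a (t i)).comp hF

/-- The cylinder `[ω]_U`. -/
def cylinder {A : Type*} (U : Finset ℕ) (ω : ℕ → A) : Set (ℕ → A) :=
  {x | ∀ i ∈ U, x i = ω i}

/-- The kernel `F_ε` gives to every cylinder the product of the local probabilities. -/
theorem perturbation_cylinder {A : Type*} [Fintype A] [Nonempty A] [DecidableEq A]
    [MeasurableSpace A] [MeasurableSingletonClass A] [TopologicalSpace A] [DiscreteTopology A]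
    (F : C(ℕ → A, ℕ → A)) (ε : unitInterval) (x : ℕ → A) (U : Finset ℕ) (ω : ℕ → A) :
    perturbation F ε x (cylinder U ω) =
      ∏ i ∈ U, ENNReal.ofReal
        ((1 - ε) * (if ω i = F x i then 1 else 0) + ε / Fintype.card A) := by
  have h : cylinder U ω = Set.pi (U : Set ℕ) fun i => {ω i} := by
    ext y; simp [cylinder, Set.mem_pi]
  rw [h]
  change Measure.infinitePi (fun i => noisyCell ε (F x i)) _ = _
  rw [Measure.infinitePi_pi _ fun i _ => measurableSet_singleton _]
  simp [noisyCell_singleton]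

/-- The action `μ ↦ F_ε μ = ∫ F_ε(x, ·) dμ(x)` on measures. -/
def act {A : Type*} [Fintype A] [Nonempty A] [MeasurableSpace A]
    [MeasurableSingletonClass A] [TopologicalSpace A] [DiscreteTopology A]
    (F : C(ℕ → A, ℕ → A)) (ε : unitInterval) (μ : Measure (ℕ → A)) : Measure (ℕ → A) :=
  μ.bind (perturbation F ε)

/-- The set of `F_ε`-invariant probability measures. -/
def invariantMeasures {A : Type*} [Fintype A] [Nonempty A] [MeasurableSpace A]
    [MeasurableSingletonClass A] [TopologicalSpace A] [DiscreteTopology A]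
    (F : C(ℕ → A, ℕ → A)) (ε : unitInterval) : Set (Measure (ℕ → A)) :=
  {μ | IsProbabilityMeasure μ ∧ act F ε μ = μ}

/-- Weak convergence of measures on `A^ℕ`: convergence on every cylinder. -/
def WeaklyConverges {A : Type*} [MeasurableSpace A]
    (μ : ℕ → Measure (ℕ → A)) (π : Measure (ℕ → A)) : Prop :=
  ∀ (U : Finset ℕ) (ω : ℕ → A),
    Tendsto (fun t => μ t (cylinder U ω)) atTop (𝓝 (π (cylinder U ω)))

/-- `F_ε` is ergodic: it has a unique invariant probability measure `π`, and the iterates of every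
initial probability measure converge weakly to `π`. -/
def IsErgodic {A : Type*} [Fintype A] [Nonempty A] [MeasurableSpace A]
    [MeasurableSingletonClass A] [TopologicalSpace A] [DiscreteTopology A]
    (F : C(ℕ → A, ℕ → A)) (ε : unitInterval) : Prop :=
  ∃ π : Measure (ℕ → A), invariantMeasures F ε = {π} ∧
    ∀ μ : Measure (ℕ → A), IsProbabilityMeasure μ →
      WeaklyConverges (fun t => (act F ε)^[t] μ) π

/-- `Uni(F)`: the noise levels at which there is a unique invariant probability measure. -/
def uni {A : Type*} [Fintype A] [Nonempty A] [MeasurableSpace A]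
    [MeasurableSingletonClass A] [TopologicalSpace A] [DiscreteTopology A]
    (F : C(ℕ → A, ℕ → A)) : Set unitInterval :=
  {ε | ∃ π, invariantMeasures F ε = {π}}

/-- `Erg(F)`: the noise levels at which the perturbation is ergodic. -/
def erg {A : Type*} [Fintype A] [Nonempty A] [MeasurableSpace A]
    [MeasurableSingletonClass A] [TopologicalSpace A] [DiscreteTopology A]
    (F : C(ℕ → A, ℕ → A)) : Set unitInterval :=
  {ε | IsErgodic F ε}

/-! ### Majority maps; the symbols `0` and `1` are `false` and `true` -/

/-- A map of `A^ℕ` each of whose cells depends on finitely many cells is continuous. -/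
theorem continuous_of_local {A : Type*} [TopologicalSpace A] [DiscreteTopology A]
    (F : (ℕ → A) → ℕ → A) (N : ℕ → Finset ℕ)
    (h : ∀ i x y, (∀ j ∈ N i, x j = y j) → F x i = F y i) : Continuous F := by
  refine continuous_pi fun i => IsLocallyConstant.continuous ?_
  rw [IsLocallyConstant.iff_exists_open]
  intro x
  refine ⟨Set.pi (N i : Set ℕ) fun j => {x j},
    isOpen_set_pi (N i).finite_toSet fun _ _ => isOpen_discrete _, by simp, fun y hy => ?_⟩
  exact h i y x fun j hj => by simpa using hy j hj

/-- The cells `(2n+1)i + 1, …, (2n+1)i + 2n+1`. -/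
def block (n i : ℕ) : Finset ℕ :=
  Finset.Icc ((2 * n + 1) * i + 1) ((2 * n + 1) * i + (2 * n + 1))

/-- The majority symbol of `y` among the `2n+1` cells of `block n i`. -/
def blockMaj (n i : ℕ) (y : ℕ → Bool) : Bool :=
  decide (n + 1 ≤ ((block n i).filter fun j => y j = true).card)

theorem blockMaj_congr (n i : ℕ) {y y' : ℕ → Bool} (h : ∀ j ∈ block n i, y j = y' j) :
    blockMaj n i y = blockMaj n i y' := by
  unfold blockMaj
  rw [Finset.filter_congr fun j hj => by rw [h j hj]]

/-- The map `maj_{2n+1}` of `{0,1}^ℕ`. -/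
def maj (n : ℕ) : C(ℕ → Bool, ℕ → Bool) where
  toFun y i := blockMaj n i y
  continuous_toFun :=
    continuous_of_local _ (block n) fun i _ _ h => blockMaj_congr n i h

/-- The infimum of the noise levels `ε < 1` at which `maj_{2n+1}` has a unique invariant
probability measure. -/
def threshold (n : ℕ) : ℝ :=
  sInf {r : ℝ | ∃ ε ∈ uni (maj n), (ε : ℝ) < 1 ∧ (ε : ℝ) = r}

/-- The frequency of the symbol `1` in `z` over the cells of `S`. -/
def freq (S : Finset ℕ) (z : ℕ → Bool) : ℝ :=
  (∑ j ∈ S, if z j = true then (1 : ℝ) else 0) / S.card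

theorem freq_congr (S : Finset ℕ) {z z' : ℕ → Bool} (h : ∀ j ∈ S, z j = z' j) :
    freq S z = freq S z' := by
  unfold freq
  rw [Finset.sum_congr rfl fun j hj => by rw [h j hj]]

open Classical in
/-- The map `maj_{2n+1}^{I,E}` of `({0,1} × {0,1})^ℕ`: cell `i` receives `(0, 0)` if twice the
frequency of `1` on the second layer over `E i` is in `I i`, and otherwise the majority of the
first layer over `block n i`, together with `0` on the second layer. -/
def majAux (n : ℕ) (I : ℕ → Set ℝ) (E : ℕ → Finset ℕ) :
    C(ℕ → Bool × Bool, ℕ → Bool × Bool) where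
  toFun x i :=
    if 2 * freq (E i) (fun j => (x j).2) ∈ I i then (false, false)
    else (blockMaj n i (fun j => (x j).1), false)
  continuous_toFun := by
    refine continuous_of_local _ (fun i => block n i ∪ E i) fun i x y h => ?_
    have h1 : blockMaj n i (fun j => (x j).1) = blockMaj n i (fun j => (y j).1) :=
      blockMaj_congr n i fun j hj => by rw [h j (Finset.mem_union_left _ hj)]
    have h2 : freq (E i) (fun j => (x j).2) = freq (E i) (fun j => (y j).2) :=
      freq_congr (E i) fun j hj => by rw [h j (Finset.mem_union_right _ hj)]
    simp only [h1, h2]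

end NoisyMajority

end

/-! Every image under `majAux` has second layer `0`, so after the noise that layer consists of
independent symbols equal to `1` with probability `ε / 2`, and twice their frequency over a large
set of cells estimates `ε`. The families are chosen so that cell `i` resets when the estimate lies
well inside `O`: `resetWindow O i` asks for distance at least `1 / (i + 1)` from the complement, and
`resetCells n i` is so large that, by Chebyshev, the estimate errs by that much with probability at
most `weight n i`. The total weight at least halves from a set of cells to the cells that its
majorities read (`totalWeight_children_le`), so the errors sum up along the tree of blocks.

If `ε ∈ O` and `ε < 1`, far cells are almost always reset. The initial condition acts only through
ever farther cells, so it is forgotten (`oscVanishes_auxOp_of_resets`). At `ε = 1` the kernel is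
constant. If `ε ∉ O`, the map stays close, at all times and on far cells, to the noisy majority map
(`abs_iterate_auxOp_sub_iterate_majOp_le`). It then inherits either loss of memory
(`oscVanishes_auxOp_of_noLowFixedPoint`) or coexistence of several invariant measures
(`notMem_uni_majAux`).

For the noisy majority map the blocks are disjoint, so product Bernoulli laws are preserved and
their parameter follows `meanField`. If this recursion has no fixed point below `1/2`, its orbits
from `0` and `1` both tend to `1/2`, and monotonicity of the dynamics forces all oscillations to
vanish. Otherwise, for `ε < 1`, two Bernoulli laws are invariant. Absence of a low fixed point is
monotone in `ε` and, by strict convexity of `majPoly` on `[0, 1/2]`, persists at the infimum; it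
therefore holds exactly from `threshold n` on. -/

noncomputable section

namespace NoisyMajority

/-! ### Iterating the kernel on bounded functions -/

/-- Bounded measurable real functions. -/
def BddMeas {X : Type*} [MeasurableSpace X] (g : X → ℝ) : Prop :=
  Measurable g ∧ ∃ C : ℝ, ∀ x, |g x| ≤ C

theorem BddMeas.integrable {X : Type*} [MeasurableSpace X] {g : X → ℝ} (hg : BddMeas g)
    (μ : Measure X) [IsFiniteMeasure μ] : Integrable g μ := by
  obtain ⟨hm, C, hC⟩ := hg
  exact Integrable.of_bound hm.aestronglyMeasurable C (ae_of_all _ hC)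

theorem abs_integral_le_of_forall {X : Type*} [MeasurableSpace X] {g : X → ℝ} {C : ℝ}
    (μ : Measure X) [IsProbabilityMeasure μ] (h : ∀ x, |g x| ≤ C) : |∫ x, g x ∂μ| ≤ C := by
  simpa using norm_integral_le_of_norm_le_const (μ := μ) (f := g) (C := C) (ae_of_all _ h)

set_option linter.unusedSectionVars false

section Kernel

variable {A : Type*} [Fintype A] [Nonempty A] [MeasurableSpace A]
    [MeasurableSingletonClass A] [TopologicalSpace A] [DiscreteTopology A]

theorem borelSpace_alphabet : BorelSpace A := ⟨by
  rw [borel_eq_top_of_discrete]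
  exact top_le_iff.1 fun s _ => s.toFinite.measurableSet⟩

theorem perturbation_apply (F : C(ℕ → A, ℕ → A)) (ε : unitInterval) (x : ℕ → A) :
    perturbation F ε x = Measure.infinitePi fun i => noisyCell ε (F x i) := rfl

instance isMarkovKernel_perturbation (F : C(ℕ → A, ℕ → A)) (ε : unitInterval) :
    IsMarkovKernel (perturbation F ε) :=
  ⟨fun x => by rw [perturbation_apply]; infer_instance⟩

instance isProbabilityMeasure_act (F : C(ℕ → A, ℕ → A)) (ε : unitInterval)
    (μ : Measure (ℕ → A)) [IsProbabilityMeasure μ] : IsProbabilityMeasure (act F ε μ) := by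
  unfold act; infer_instance

theorem isProbabilityMeasure_iterate_act (F : C(ℕ → A, ℕ → A)) (ε : unitInterval)
    (μ : Measure (ℕ → A)) [hμ : IsProbabilityMeasure μ] (t : ℕ) :
    IsProbabilityMeasure ((act F ε)^[t] μ) := by
  induction t with
  | zero => simpa
  | succ t ih => rw [Function.iterate_succ_apply']; infer_instance

/-- The kernel as an operator on functions. -/
def markovOp (F : C(ℕ → A, ℕ → A)) (ε : unitInterval) (g : (ℕ → A) → ℝ) (x : ℕ → A) : ℝ :=
  ∫ y, g y ∂(perturbation F ε x)

theorem BddMeas.markovOp {g : (ℕ → A) → ℝ} (hg : BddMeas g) (F : C(ℕ → A, ℕ → A))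
    (ε : unitInterval) : BddMeas (markovOp F ε g) := by
  obtain ⟨hm, C, hC⟩ := hg
  exact ⟨hm.stronglyMeasurable.integral_kernel.measurable, C,
    fun x => abs_integral_le_of_forall _ hC⟩

theorem BddMeas.iterate_markovOp {g : (ℕ → A) → ℝ} (hg : BddMeas g) (F : C(ℕ → A, ℕ → A))
    (ε : unitInterval) (t : ℕ) : BddMeas ((NoisyMajority.markovOp F ε)^[t] g) := by
  induction t with
  | zero => simpa
  | succ t ih => rw [Function.iterate_succ_apply']; exact ih.markovOp F ε

theorem integral_act (F : C(ℕ → A, ℕ → A)) (ε : unitInterval) (μ : Measure (ℕ → A))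
    [IsProbabilityMeasure μ] {g : (ℕ → A) → ℝ} (hg : BddMeas g) :
    ∫ y, g y ∂(act F ε μ) = ∫ x, markovOp F ε g x ∂μ := by
  have h : act F ε μ = ((perturbation F ε) ∘ₖ (Kernel.const Unit μ)) () := by
    rw [Kernel.comp_apply, Kernel.const_apply]; rfl
  have hi := hg.integrable (act F ε μ)
  rw [h] at hi ⊢
  rw [Kernel.integral_comp hi, Kernel.const_apply]
  rfl

theorem integral_iterate_act (F : C(ℕ → A, ℕ → A)) (ε : unitInterval) (μ : Measure (ℕ → A))
    [IsProbabilityMeasure μ] {g : (ℕ → A) → ℝ} (hg : BddMeas g) (t : ℕ) :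
    ∫ y, g y ∂((act F ε)^[t] μ) = ∫ x, (markovOp F ε)^[t] g x ∂μ := by
  induction t generalizing g with
  | zero => rfl
  | succ t ih =>
    have := isProbabilityMeasure_iterate_act F ε μ t
    rw [Function.iterate_succ_apply', integral_act F ε _ hg, ih (hg.markovOp F ε),
      Function.iterate_succ_apply]

open Classical in
/-- The indicator function of a cylinder. -/
def cylInd (U : Finset ℕ) (ω : ℕ → A) (x : ℕ → A) : ℝ :=
  ∏ i ∈ U, if x i = ω i then 1 else 0

theorem measurableSet_cylinder (U : Finset ℕ) (ω : ℕ → A) : MeasurableSet (cylinder U ω) := by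
  have : cylinder U ω = ⋂ i ∈ U, (fun x : ℕ → A => x i) ⁻¹' {ω i} := by
    ext; simp [cylinder]
  rw [this]
  exact Finset.measurableSet_biInter _ fun i _ =>
    (measurable_pi_apply i) (measurableSet_singleton _)

theorem cylInd_eq_indicator (U : Finset ℕ) (ω : ℕ → A) :
    cylInd U ω = (cylinder U ω).indicator fun _ => (1 : ℝ) := by
  classical
  ext x
  by_cases h : x ∈ cylinder U ω
  · rw [Set.indicator_of_mem h]
    exact Finset.prod_eq_one fun i hi => if_pos (h i hi)
  · rw [Set.indicator_of_notMem h]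
    simp only [cylinder, Set.mem_ofPred_eq, not_forall] at h
    obtain ⟨i, hi, hne⟩ := h
    exact Finset.prod_eq_zero hi (if_neg hne)

theorem cylInd_mem_Icc (U : Finset ℕ) (ω x : ℕ → A) : cylInd U ω x ∈ Set.Icc (0 : ℝ) 1 := by
  classical
  rw [cylInd_eq_indicator, Set.indicator_apply]
  split_ifs <;> simp

theorem bddMeas_cylInd (U : Finset ℕ) (ω : ℕ → A) : BddMeas (cylInd U ω) := by
  refine ⟨?_, 1, fun x => ?_⟩
  · rw [cylInd_eq_indicator]
    exact measurable_const.indicator (measurableSet_cylinder U ω)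
  · obtain ⟨h0, h1⟩ := cylInd_mem_Icc U ω x
    rwa [abs_of_nonneg h0]

theorem continuous_cylInd (U : Finset ℕ) (ω : ℕ → A) : Continuous (cylInd U ω) := by
  classical
  refine continuous_finsetProd _ fun i _ => ?_
  exact (continuous_of_discreteTopology (f := fun a : A => if a = ω i then (1 : ℝ) else 0)).comp
    (continuous_apply i)

theorem integral_cylInd (μ : Measure (ℕ → A)) (U : Finset ℕ) (ω : ℕ → A) :
    ∫ x, cylInd U ω x ∂μ = μ.real (cylinder U ω) := by
  rw [cylInd_eq_indicator, integral_indicator (measurableSet_cylinder U ω)]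
  simp

/-- The Feller property, which lets limits of averaged laws be invariant: the value is a finite
product of functions of single cells of `F x`, and `F` is continuous. -/
theorem continuous_markovOp_cylInd (F : C(ℕ → A, ℕ → A)) (ε : unitInterval) (U : Finset ℕ)
    (ω : ℕ → A) : Continuous (markovOp F ε (cylInd U ω)) := by
  classical
  have : markovOp F ε (cylInd U ω) = fun x => ∏ i ∈ U, (ENNReal.ofReal
        ((1 - ε) * (if ω i = F x i then 1 else 0) + ε / Fintype.card A)).toReal := by
    ext x
    rw [markovOp, integral_cylInd, measureReal_def, perturbation_cylinder, ENNReal.toReal_prod]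
  rw [this]
  refine continuous_finsetProd _ fun i _ => ?_
  exact (continuous_of_discreteTopology (f := fun a : A => (ENNReal.ofReal
    ((1 - ε) * (if ω i = a then 1 else 0) + ε / Fintype.card A)).toReal)).comp
    ((continuous_apply i).comp F.continuous)

theorem measure_ext_of_cylinder {μ ν : Measure (ℕ → A)} [IsProbabilityMeasure μ]
    [IsProbabilityMeasure ν] (h : ∀ (U : Finset ℕ) (ω : ℕ → A),
      μ (cylinder U ω) = ν (cylinder U ω)) : μ = ν := by
  have hr : ∀ U : Finset ℕ, ν.map U.restrict = μ.map U.restrict := fun U => by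
    refine Measure.ext_of_singleton fun a => ?_
    -- The symbol chosen outside `U` is irrelevant, since the cylinder constrains only the cells of
    -- `U`.
    have hp : (U.restrict (π := fun _ => A)) ⁻¹' {a} = cylinder U
        (fun i => if hi : i ∈ U then a ⟨i, hi⟩ else Classical.arbitrary A) := by
      ext x
      simp only [Set.mem_preimage, Set.mem_singleton_iff, cylinder, Set.mem_ofPred_eq]
      constructor
      · rintro rfl i hi; simp [hi]
      · intro hx; ext ⟨i, hi⟩; simpa [hi] using hx i hi
    rw [Measure.map_apply (by fun_prop) (measurableSet_singleton _),
      Measure.map_apply (by fun_prop) (measurableSet_singleton _), hp, h]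
  have hμ : IsProjectiveLimit μ fun U : Finset ℕ => μ.map U.restrict := fun U => rfl
  have hν : IsProjectiveLimit ν fun U : Finset ℕ => μ.map U.restrict := hr
  have : ∀ U : Finset ℕ, IsFiniteMeasure (μ.map U.restrict) := fun U => inferInstance
  exact hμ.unique hν

/-- Krylov–Bogoliubov, with control of the integral of one continuous function. -/
theorem exists_invariant_le_integral (F : C(ℕ → A, ℕ → A)) (ε : unitInterval)
    (ν : Measure (ℕ → A)) [IsProbabilityMeasure ν] {g : (ℕ → A) → ℝ} (hg : BddMeas g)
    (hgc : Continuous g) (c : ℝ) (hc : ∀ t, c ≤ ∫ x, (markovOp F ε)^[t] g x ∂ν) :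
    ∃ π ∈ invariantMeasures F ε, c ≤ ∫ x, g x ∂π := by
  have := borelSpace_alphabet (A := A)
  have hprob := isProbabilityMeasure_iterate_act F ε ν
  let m : ℕ → Measure (ℕ → A) := fun T =>
    ((T : ENNReal) + 1)⁻¹ • ∑ t ∈ Finset.range (T + 1), (act F ε)^[t] ν
  have hm : ∀ T, IsProbabilityMeasure (m T) := fun T => ⟨by
    simp only [m, Measure.smul_apply, Measure.finsetSum_apply, measure_univ, smul_eq_mul]
    simp only [Finset.sum_const, Finset.card_range, nsmul_eq_mul, mul_one, Nat.cast_add,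
      Nat.cast_one]
    exact ENNReal.inv_mul_cancel (by simp) (by simp)⟩
  have hint : ∀ T {h : (ℕ → A) → ℝ}, BddMeas h → ∫ x, h x ∂(m T) =
      ((T : ℝ) + 1)⁻¹ * ∑ t ∈ Finset.range (T + 1), ∫ x, (markovOp F ε)^[t] h x ∂ν := by
    intro T h hh
    simp only [m]
    rw [integral_smul_measure, integral_finsetSum_measure fun i _ => hh.integrable _, smul_eq_mul]
    congr 1
    · rw [ENNReal.toReal_inv]; norm_cast
    · exact Finset.sum_congr rfl fun t _ => integral_iterate_act F ε ν hh t
  let M : ℕ → ProbabilityMeasure (ℕ → A) := fun T => ⟨m T, hm T⟩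
  obtain ⟨π, hπ⟩ := exists_clusterPt_of_compactSpace (map M atTop)
  -- Compactness gives a cluster point of the Cesàro averages; an ultrafilter replaces a convergent
  -- subsequence.
  obtain ⟨V, hV, hlim⟩ := (mapClusterPt_iff_ultrafilter).1 (show MapClusterPt π atTop M from hπ)
  rw [ProbabilityMeasure.tendsto_iff_forall_integral_tendsto] at hlim
  have hlim' : ∀ h : (ℕ → A) → ℝ, Continuous h → BddMeas h →
      Tendsto (fun T => ∫ x, h x ∂(m T)) V (𝓝 (∫ x, h x ∂(π : Measure (ℕ → A)))) := by
    intro h hh _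
    exact hlim (BoundedContinuousFunction.mkOfCompact ⟨h, hh⟩)
  refine ⟨π, ⟨inferInstance, measure_ext_of_cylinder fun U ω => ?_⟩, ?_⟩
  · have hb := bddMeas_cylInd U ω
    have h1 := hlim' _ (continuous_cylInd U ω) hb
    have h2 := hlim' _ (continuous_markovOp_cylInd F ε U ω) (hb.markovOp F ε)
    -- One step of the kernel changes a Cesàro average only by its two end terms, each at most `1`
    -- on a cylinder, divided by `T + 1`.
    have h3 : Tendsto (fun T : ℕ => 2 * ((T : ℝ) + 1)⁻¹) V (𝓝 0) := by
      have := (tendsto_one_div_add_atTop_nhds_zero_nat (𝕜 := ℝ)).mono_left hV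
      simpa using this.const_mul 2
    have h4 : Tendsto (fun T => ∫ x, markovOp F ε (cylInd U ω) x ∂(m T) -
        ∫ x, cylInd U ω x ∂(m T)) V (𝓝 0) := by
      refine squeeze_zero_norm (fun T => ?_) h3
      rw [hint T hb, hint T (hb.markovOp F ε), ← mul_sub]
      simp_rw [← Function.iterate_succ_apply]
      rw [← Finset.sum_sub_distrib, Finset.sum_range_sub
        (fun t => ∫ x, (markovOp F ε)^[t] (cylInd U ω) x ∂ν), norm_mul, mul_comm]
      have hpos : (0 : ℝ) < (T : ℝ) + 1 := by positivity
      rw [Real.norm_of_nonneg (inv_nonneg.2 hpos.le)]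
      refine mul_le_mul_of_nonneg_right ?_ (inv_nonneg.2 hpos.le)
      rw [← integral_iterate_act F ε ν hb, ← integral_iterate_act F ε ν hb, integral_cylInd,
        integral_cylInd]
      refine (norm_sub_le _ _).trans ?_
      rw [Real.norm_of_nonneg measureReal_nonneg, Real.norm_of_nonneg measureReal_nonneg]
      linarith [measureReal_le_one (μ := (act F ε)^[T + 1] ν) (s := cylinder U ω),
        measureReal_le_one (μ := (act F ε)^[0] ν) (s := cylinder U ω)]
    have h5 := tendsto_nhds_unique h4 (h2.sub h1)
    rw [← integral_act F ε _ hb, integral_cylInd, integral_cylInd] at h5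
    exact (measureReal_eq_measureReal_iff).1 (sub_eq_zero.1 h5.symm)
  · refine ge_of_tendsto' (hlim' g hgc hg) fun T => ?_
    rw [hint T hg]
    have hpos : (0 : ℝ) < (T : ℝ) + 1 := by positivity
    rw [← div_eq_inv_mul, le_div_iff₀ hpos]
    calc c * (T + 1) = ∑ t ∈ Finset.range (T + 1), c := by simp; ring
      _ ≤ _ := Finset.sum_le_sum fun t _ => hc t

/-- If iterating the kernel makes the oscillation of every cylinder function vanish, the kernel is
ergodic. -/
theorem isErgodic_of_oscillation (F : C(ℕ → A, ℕ → A)) (ε : unitInterval)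
    (h : ∀ (U : Finset ℕ) (ω : ℕ → A), ∀ η > 0, ∃ t₀, ∀ t ≥ t₀, ∀ x y,
      |(markovOp F ε)^[t] (cylInd U ω) x - (markovOp F ε)^[t] (cylInd U ω) y| ≤ η) :
    IsErgodic F ε := by
  -- Only existence is wanted here, so the controlled function is `0`.
  obtain ⟨π, hπ, -⟩ := exists_invariant_le_integral F ε
    (Measure.dirac fun _ => Classical.arbitrary A) (g := fun _ => 0)
    ⟨measurable_const, 0, by simp⟩ continuous_const 0 fun t => by
      suffices (markovOp F ε)^[t] (fun _ => (0 : ℝ)) = fun _ => 0 by simp [this]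
      exact Function.iterate_fixed (by ext; simp [markovOp]) t
  have hconv : ∀ μ : Measure (ℕ → A), IsProbabilityMeasure μ →
      WeaklyConverges (fun t => (act F ε)^[t] μ) π := by
    intro μ hμ U ω
    have hπ1 := hπ.1
    have hp := isProbabilityMeasure_iterate_act F ε μ
    have hb := bddMeas_cylInd U ω
    rw [← ENNReal.tendsto_toReal_iff (fun t => measure_ne_top _ _) (measure_ne_top _ _)]
    rw [Metric.tendsto_atTop]
    intro η hη
    obtain ⟨t₀, ht₀⟩ := h U ω (η / 2) (half_pos hη)
    refine ⟨t₀, fun t ht => ?_⟩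
    change |((act F ε)^[t] μ).real (cylinder U ω) - π.real (cylinder U ω)| < η
    have hfix : (act F ε)^[t] π = π := Function.iterate_fixed hπ.2 t
    have e1 : ((act F ε)^[t] μ).real (cylinder U ω) =
        ∫ x, (markovOp F ε)^[t] (cylInd U ω) x ∂μ := by
      rw [← integral_cylInd, integral_iterate_act F ε μ hb]
    have e2 : π.real (cylinder U ω) = ∫ y, (markovOp F ε)^[t] (cylInd U ω) y ∂π := by
      rw [← integral_iterate_act F ε π hb, hfix, integral_cylInd]
    have hbt := hb.iterate_markovOp F ε t
    rw [e1, e2]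
    refine lt_of_le_of_lt ?_ (half_lt_self hη)
    set f := (markovOp F ε)^[t] (cylInd U ω) with hf
    have e3 : ∫ x, f x ∂μ - ∫ y, f y ∂π = ∫ x, (f x - ∫ y, f y ∂π) ∂μ := by
      rw [integral_sub (hbt.integrable μ) (integrable_const _)]; simp
    rw [e3]
    refine abs_integral_le_of_forall μ fun x => ?_
    have e4 : f x - ∫ y, f y ∂π = ∫ y, (f x - f y) ∂π := by
      rw [integral_sub (integrable_const _) (hbt.integrable π)]; simp
    rw [e4]
    exact abs_integral_le_of_forall π fun y => ht₀ t ht x y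
  refine ⟨π, ?_, hconv⟩
  refine Set.eq_singleton_iff_unique_mem.2 ⟨hπ, fun μ hμ => ?_⟩
  have := hμ.1
  have := hπ.1
  refine measure_ext_of_cylinder fun U ω => ?_
  have h1 := hconv μ hμ.1 U ω
  simp only [Function.iterate_fixed hμ.2] at h1
  exact tendsto_nhds_unique tendsto_const_nhds h1

theorem erg_subset_uni (F : C(ℕ → A, ℕ → A)) : erg F ⊆ uni F :=
  fun _ ⟨π, hπ, _⟩ => ⟨π, hπ⟩

end Kernel

/-! ### The majority polynomial -/

/-- The probability that the majority of `2n+1` independent Bernoulli variables of parameter `p`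
is `1`, as a polynomial in `p`. -/
def majPoly (n : ℕ) : Polynomial ℝ :=
  ∑ k ∈ Finset.range (n + 1), bernsteinPolynomial ℝ (2 * n + 1) (n + 1 + k)

/-- The derivatives of consecutive Bernstein polynomials telescope, which leaves only the central
one; hence the slope is a multiple of `(x * (1 - x)) ^ n`. -/
theorem derivative_majPoly (n : ℕ) :
    (majPoly n).derivative = (2 * n + 1 : ℕ) * bernsteinPolynomial ℝ (2 * n) n := by
  have h : ∀ k, (bernsteinPolynomial ℝ (2 * n + 1) (n + 1 + k)).derivative =
      (2 * n + 1 : ℕ) * (bernsteinPolynomial ℝ (2 * n) (n + k) -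
        bernsteinPolynomial ℝ (2 * n) (n + (k + 1))) := fun k => by
    have := bernsteinPolynomial.derivative_succ ℝ (2 * n + 1) (n + k)
    rw [show n + 1 + k = n + k + 1 by ring, this]
    rfl
  rw [majPoly, Polynomial.derivative_sum, Finset.sum_congr rfl fun k _ => h k, ← Finset.mul_sum,
    Finset.sum_range_sub' fun k => bernsteinPolynomial ℝ (2 * n) (n + k),
    bernsteinPolynomial.eq_zero_of_lt ℝ (show 2 * n < n + (n + 1) by omega)]
  simp

/-- The coefficient of the derivative of the majority polynomial. -/
def majSlope (n : ℕ) : ℝ := (2 * n + 1 : ℕ) * ((2 * n).choose n : ℝ)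

theorem majSlope_pos (n : ℕ) : 0 < majSlope n := by
  have : 0 < (2 * n).choose n := Nat.choose_pos (by omega)
  unfold majSlope
  positivity

theorem deriv_majPoly (n : ℕ) (x : ℝ) :
    deriv (fun p => (majPoly n).eval p) x = majSlope n * (x * (1 - x)) ^ n := by
  rw [Polynomial.deriv, derivative_majPoly, majSlope, mul_pow]
  simp [bernsteinPolynomial, two_mul]
  ring

theorem majPoly_zero (n : ℕ) : (majPoly n).eval 0 = 0 := by
  rw [majPoly, Polynomial.eval_finsetSum]
  refine Finset.sum_eq_zero fun k _ => ?_
  rw [bernsteinPolynomial.eval_at_0, if_neg (by omega)]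

theorem majPoly_one (n : ℕ) : (majPoly n).eval 1 = 1 := by
  rw [majPoly, Polynomial.eval_finsetSum, Finset.sum_eq_single n]
  · rw [bernsteinPolynomial.eval_at_1, if_pos (by omega)]
  · intro k _ hk
    rw [bernsteinPolynomial.eval_at_1, if_neg (by omega)]
  · simp

/-- The slope is symmetric under `x ↦ 1 - x`, so the sum of the two values is constant and can be
read off at `0`. -/
theorem majPoly_one_sub (n : ℕ) (p : ℝ) : (majPoly n).eval (1 - p) = 1 - (majPoly n).eval p := by
  have hd : Differentiable ℝ fun p => (majPoly n).eval p := (majPoly n).differentiable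
  have hd' : Differentiable ℝ fun p : ℝ => (majPoly n).eval (1 - p) :=
    hd.comp (differentiable_const (1 : ℝ) |>.sub differentiable_id)
  have := is_const_of_deriv_eq_zero (f := fun p => (majPoly n).eval (1 - p) + (majPoly n).eval p)
    (hd'.add hd) (fun x => by
      rw [deriv_fun_add (hd' x) (hd x), deriv_comp_const_sub (f := fun p => (majPoly n).eval p),
        deriv_majPoly, deriv_majPoly]
      ring) p 0
  simp only [sub_zero, majPoly_zero, majPoly_one] at this
  linarith

theorem majPoly_half (n : ℕ) : (majPoly n).eval (1 / 2) = 1 / 2 := by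
  have := majPoly_one_sub n (1 / 2)
  norm_num at this ⊢
  linarith

theorem continuous_majPoly (n : ℕ) : Continuous fun p => (majPoly n).eval p :=
  (majPoly n).continuous

theorem strictMonoOn_majPoly (n : ℕ) :
    StrictMonoOn (fun p => (majPoly n).eval p) (Set.Icc 0 1) := by
  refine strictMonoOn_of_deriv_pos (convex_Icc 0 1) (continuous_majPoly n).continuousOn ?_
  intro x hx
  rw [interior_Icc] at hx
  rw [deriv_majPoly]
  have := majSlope_pos n
  have h1 : 0 < x := hx.1
  have h2 : 0 < 1 - x := by linarith [hx.2]
  positivity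

theorem majPoly_mem_Icc (n : ℕ) {p : ℝ} (hp : p ∈ Set.Icc (0 : ℝ) 1) :
    (majPoly n).eval p ∈ Set.Icc (0 : ℝ) 1 := by
  have h := (strictMonoOn_majPoly n).monotoneOn
  constructor
  · simpa [majPoly_zero] using h ⟨le_rfl, zero_le_one⟩ hp hp.1
  · simpa [majPoly_one] using h hp ⟨zero_le_one, le_rfl⟩ hp.2

theorem strictConvexOn_majPoly {n : ℕ} (hn : 1 ≤ n) :
    StrictConvexOn ℝ (Set.Icc 0 (1 / 2)) fun p => (majPoly n).eval p := by
  refine StrictMonoOn.strictConvexOn_of_deriv (convex_Icc _ _) (continuous_majPoly n).continuousOn ?_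
  intro x hx y hy hxy
  rw [interior_Icc] at hx hy
  rw [deriv_majPoly, deriv_majPoly]
  refine mul_lt_mul_of_pos_left ?_ (majSlope_pos n)
  refine pow_lt_pow_left₀ ?_ (mul_nonneg hx.1.le (by linarith [hx.2])) (by omega)
  nlinarith [hx.1, hx.2, hy.1, hy.2]

/-- A Lipschitz bound: on `[0, 1]` the derivative is at most `majSlope n`, because `x * (1 - x) ≤
1`. -/
theorem half_sub_majPoly_le (n : ℕ) {q : ℝ} (hq : q ∈ Set.Icc (0 : ℝ) (1 / 2)) :
    1 / 2 - (majPoly n).eval q ≤ majSlope n * (1 / 2 - q) := by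
  have hd : Differentiable ℝ fun p => (majPoly n).eval p := (majPoly n).differentiable
  have hl : Differentiable ℝ fun p : ℝ => majSlope n * p := by fun_prop
  have h : MonotoneOn (fun p => majSlope n * p - (majPoly n).eval p) (Set.Icc 0 1) := by
    refine monotoneOn_of_deriv_nonneg (convex_Icc 0 1) (hl.sub hd).continuous.continuousOn
      (hl.sub hd).differentiableOn ?_
    intro x hx
    rw [interior_Icc] at hx
    rw [deriv_fun_sub (hl x) (hd x), deriv_majPoly]
    have h1 : x * (1 - x) ≤ 1 := by nlinarith [hx.1, hx.2]
    have h2 : 0 ≤ x * (1 - x) := mul_nonneg hx.1.le (by linarith [hx.2])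
    have h3 := pow_le_one₀ h2 h1 (n := n)
    have h4 := majSlope_pos n
    rw [show deriv (fun p : ℝ => majSlope n * p) x = majSlope n by simp]
    nlinarith
  have := h ⟨hq.1, by linarith [hq.2]⟩ ⟨by norm_num, by norm_num⟩ hq.2
  simp only [majPoly_half] at this
  linarith

/-! ### The mean-field recursion and its fixed points -/

/-- One step of the mean-field recursion: noise, then majority. -/
def meanField (n : ℕ) (ε p : ℝ) : ℝ := (majPoly n).eval ((1 - ε) * p + ε / 2)

/-- The mean-field recursion has no fixed point below `1/2`. -/
def NoLowFixedPoint (n : ℕ) (ε : ℝ) : Prop := ∀ p ∈ Set.Ico (0 : ℝ) (1 / 2), meanField n ε p ≠ p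

theorem noise_mem_Icc {ε p : ℝ} (hε : ε ∈ Set.Icc (0 : ℝ) 1) (hp : p ∈ Set.Icc (0 : ℝ) 1) :
    (1 - ε) * p + ε / 2 ∈ Set.Icc (0 : ℝ) 1 := by
  obtain ⟨h0, h1⟩ := hε
  obtain ⟨h2, h3⟩ := hp
  constructor <;> nlinarith

theorem continuous_meanField (n : ℕ) (ε : ℝ) : Continuous (meanField n ε) :=
  (continuous_majPoly n).comp (by fun_prop)

theorem meanField_mem_Icc (n : ℕ) {ε p : ℝ} (hε : ε ∈ Set.Icc (0 : ℝ) 1)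
    (hp : p ∈ Set.Icc (0 : ℝ) 1) : meanField n ε p ∈ Set.Icc (0 : ℝ) 1 :=
  majPoly_mem_Icc n (noise_mem_Icc hε hp)

theorem meanField_half (n : ℕ) (ε : ℝ) : meanField n ε (1 / 2) = 1 / 2 := by
  rw [meanField, show (1 - ε) * (1 / 2) + ε / 2 = 1 / 2 by ring, majPoly_half]

theorem meanField_one_sub (n : ℕ) (ε p : ℝ) : meanField n ε (1 - p) = 1 - meanField n ε p := by
  rw [meanField, meanField, ← majPoly_one_sub]
  ring_nf

theorem monotoneOn_meanField (n : ℕ) {ε : ℝ} (hε : ε ∈ Set.Icc (0 : ℝ) 1) :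
    MonotoneOn (meanField n ε) (Set.Icc 0 1) := fun p hp q hq hpq =>
  (strictMonoOn_majPoly n).monotoneOn (noise_mem_Icc hε hp) (noise_mem_Icc hε hq) (by
    have : 0 ≤ 1 - ε := by linarith [hε.2]
    nlinarith)

theorem iterate_meanField_one (n : ℕ) (ε : ℝ) (s : ℕ) :
    (meanField n ε)^[s] 1 = 1 - (meanField n ε)^[s] 0 := by
  induction s with
  | zero => simp
  | succ s ih => rw [Function.iterate_succ_apply', ih, meanField_one_sub,
      Function.iterate_succ_apply']

/-- The orbit of `0` increases and stays below the fixed point `1/2`; its limit is a fixed point,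
and `1/2` is the only one available. -/
theorem tendsto_iterate_meanField_zero (n : ℕ) {ε : ℝ} (hε : ε ∈ Set.Icc (0 : ℝ) 1)
    (h : NoLowFixedPoint n ε) :
    Tendsto (fun s => (meanField n ε)^[s] 0) atTop (𝓝 (1 / 2)) := by
  have hmono := monotoneOn_meanField n hε
  have hbd : ∀ s, (meanField n ε)^[s] 0 ∈ Set.Icc (0 : ℝ) (1 / 2) := fun s => by
    induction s with
    | zero => simp
    | succ s ih =>
      have hs : (meanField n ε)^[s] 0 ∈ Set.Icc (0 : ℝ) 1 := ⟨ih.1, by linarith [ih.2]⟩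
      rw [Function.iterate_succ_apply']
      refine ⟨(meanField_mem_Icc n hε hs).1, ?_⟩
      rw [← meanField_half n ε]
      exact hmono hs ⟨by norm_num, by norm_num⟩ ih.2
  have hbd' : ∀ s, (meanField n ε)^[s] 0 ∈ Set.Icc (0 : ℝ) 1 :=
    fun s => ⟨(hbd s).1, by linarith [(hbd s).2]⟩
  have hinc : Monotone fun s => (meanField n ε)^[s] 0 := by
    refine monotone_nat_of_le_succ fun s => ?_
    induction s with
    | zero => exact (hbd 1).1
    | succ s ih =>
      rw [Function.iterate_succ_apply', Function.iterate_succ_apply' _ (s + 1)]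
      exact hmono (hbd' s) (hbd' (s + 1)) ih
  obtain ⟨l, hl⟩ : ∃ l, Tendsto (fun s => (meanField n ε)^[s] 0) atTop (𝓝 l) :=
    ⟨_, tendsto_atTop_ciSup hinc ⟨1 / 2, by rintro _ ⟨s, rfl⟩; exact (hbd s).2⟩⟩
  have hl0 : 0 ≤ l := ge_of_tendsto' hl fun s => (hbd s).1
  have hl1 : l ≤ 1 / 2 := le_of_tendsto' hl fun s => (hbd s).2
  have hfix : meanField n ε l = l :=
    isFixedPt_of_tendsto_iterate hl (continuous_meanField n ε).continuousAt
  rcases hl1.lt_or_eq with h' | rfl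
  · exact absurd hfix (h l ⟨hl0, h'⟩)
  · exact hl

/-- With `q = (1 - ε) * p + ε / 2`, fixed points of noise then majority become fixed points of
majority then noise. The latter map is at least the identity at `0`, so by the intermediate value
theorem it has no fixed point below `1/2` exactly when it stays strictly above the identity. In this
form the condition is monotone in `ε`. -/
theorem noLowFixedPoint_iff (n : ℕ) {ε : ℝ} (hε : ε ∈ Set.Icc (0 : ℝ) 1) :
    NoLowFixedPoint n ε ↔ ∀ q ∈ Set.Ico (0 : ℝ) (1 / 2),
      (1 - ε) * (1 / 2 - (majPoly n).eval q) < 1 / 2 - q := by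
  constructor
  · intro h q hq
    by_contra! hc
    have hcont : ContinuousOn (fun x => (1 - ε) * (majPoly n).eval x + ε / 2 - x)
        (Set.Icc 0 q) := by
      have := continuous_majPoly n
      fun_prop
    have h0 : (0 : ℝ) ∈ Set.Icc ((1 - ε) * (majPoly n).eval q + ε / 2 - q)
        ((1 - ε) * (majPoly n).eval 0 + ε / 2 - 0) := by
      rw [majPoly_zero]
      exact ⟨by linarith, by linarith [hε.1]⟩
    obtain ⟨r, hr, hr0⟩ := intermediate_value_Icc' hq.1 hcont h0
    have hr1 : r < 1 / 2 := hr.2.trans_lt hq.2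
    have hrI : r ∈ Set.Icc (0 : ℝ) 1 := ⟨hr.1, by linarith⟩
    have hlt : (majPoly n).eval r < 1 / 2 := by
      rw [← majPoly_half n]
      exact strictMonoOn_majPoly n hrI ⟨by norm_num, by norm_num⟩ hr1
    refine h _ ⟨(majPoly_mem_Icc n hrI).1, hlt⟩ ?_
    rw [meanField]
    congr 1
    linarith
  · intro h p hp hfix
    set r := (1 - ε) * p + ε / 2 with hr
    have hm : (majPoly n).eval r = p := hfix
    have hr0 : 0 ≤ r := (noise_mem_Icc hε ⟨hp.1, by linarith [hp.2]⟩).1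
    have e : 1 / 2 - r = (1 - ε) * (1 / 2 - p) := by rw [hr]; ring
    rcases hε.2.lt_or_eq with h1 | h1
    · have hpos : 0 < (1 - ε) * (1 / 2 - p) :=
        mul_pos (by linarith) (by linarith [hp.2])
      have := h r ⟨hr0, by linarith⟩
      rw [hm] at this
      linarith
    · have : r = 1 / 2 := by rw [hr, h1]; ring
      rw [this, majPoly_half] at hm
      linarith [hp.2]

/-- With `1 - ε = 1 / (majSlope n + 1)` the noise beats the Lipschitz constant of the majority
polynomial. This keeps the infimum defining the threshold from being over an empty set. -/
theorem exists_noLowFixedPoint (n : ℕ) : ∃ ε ∈ Set.Ico (0 : ℝ) 1, NoLowFixedPoint n ε := by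
  have hL := majSlope_pos n
  have h1 : 1 / (majSlope n + 1) ≤ 1 := by
    rw [div_le_one (by linarith)]; linarith
  have h0 : 0 < 1 / (majSlope n + 1) := by positivity
  refine ⟨1 - 1 / (majSlope n + 1), ⟨by linarith, by linarith⟩, ?_⟩
  rw [noLowFixedPoint_iff n ⟨by linarith, by linarith⟩]
  intro q hq
  have h2 := half_sub_majPoly_le n ⟨hq.1, hq.2.le⟩
  have h3 : 0 < 1 / 2 - q := by linarith [hq.2]
  rw [sub_sub_cancel, one_div, ← div_eq_inv_mul, div_lt_iff₀ (by linarith)]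
  nlinarith

/-- Passing to the infimum gives only the weak inequality; strict convexity makes it strict again.
This needs `1 ≤ n`: for `n = 0` the polynomial is the identity and the infimum `0` is not attained.
-/
theorem noLowFixedPoint_of_sInf_le {n : ℕ} (hn : 1 ≤ n) {ε : ℝ} (hε : ε ∈ Set.Icc (0 : ℝ) 1)
    (h : sInf {r : ℝ | r ∈ Set.Ico (0 : ℝ) 1 ∧ NoLowFixedPoint n r} ≤ ε) :
    NoLowFixedPoint n ε := by
  rw [noLowFixedPoint_iff n hε]
  have hmle : ∀ q ∈ Set.Ico (0 : ℝ) (1 / 2), 0 ≤ 1 / 2 - (majPoly n).eval q := fun q hq => by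
    have := (strictMonoOn_majPoly n).monotoneOn ⟨hq.1, by linarith [hq.2]⟩
      ⟨by norm_num, by norm_num⟩ hq.2.le
    simp only [majPoly_half] at this
    linarith
  have hweak : ∀ q ∈ Set.Ico (0 : ℝ) (1 / 2),
      (1 - ε) * (1 / 2 - (majPoly n).eval q) ≤ 1 / 2 - q := by
    intro q hq
    refine le_of_forall_pos_le_add fun δ hδ => ?_
    obtain ⟨ε₀, h₀, hfix⟩ := exists_noLowFixedPoint n
    obtain ⟨s, ⟨hs, hsfix⟩, hsε⟩ := exists_lt_of_csInf_lt (b := ε + δ)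
      (s := {r : ℝ | r ∈ Set.Ico (0 : ℝ) 1 ∧ NoLowFixedPoint n r}) ⟨ε₀, h₀, hfix⟩ (by linarith)
    have := (noLowFixedPoint_iff n ⟨hs.1, hs.2.le⟩).1 hsfix q hq
    have h1 := hmle q hq
    have h2 := (majPoly_mem_Icc n (p := q) ⟨hq.1, by linarith [hq.2]⟩).1
    nlinarith
  intro q hq
  rcases hε.2.lt_or_eq with h1 | h1
  swap
  · rw [h1]; linarith [hq.2]
  -- The chord from `q'` to `1/2` is strictly steeper than the one from `q`, so failure at `q` would
  -- contradict the weak inequality at `q'`.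
  set q' := (q + 1 / 2) / 2 with hq'
  have hqq' : q < q' := by linarith [hq.2]
  have hq'2 : q' < 1 / 2 := by linarith [hq.2]
  have hsec := (strictConvexOn_majPoly hn).secant_strict_mono
    (a := 1 / 2) (x := q) (y := q') ⟨by norm_num, le_rfl⟩ ⟨hq.1, hq.2.le⟩
    ⟨by linarith [hq.1], hq'2.le⟩ hq.2.ne hq'2.ne hqq'
  rw [majPoly_half, ← neg_div_neg_eq, ← neg_div_neg_eq (_ - _) (q' - 1 / 2), neg_sub, neg_sub,
    neg_sub, neg_sub, div_lt_div_iff₀ (by linarith [hq.2]) (by linarith)] at hsec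
  have hw := hweak q' ⟨by linarith [hq.1], hq'2⟩
  have hq0 : 0 < 1 / 2 - q := by linarith [hq.2]
  have hq'0 : 0 < 1 / 2 - q' := by linarith
  have hε1 : 0 < 1 - ε := by linarith
  have h3 := mul_lt_mul_of_pos_left hsec hε1
  have h4 := mul_le_mul_of_nonneg_right hw hq0.le
  by_contra! hc
  have h5 := mul_le_mul_of_nonneg_right hc hq'0.le
  linarith

/-! ### Bernoulli measures and the majority map -/

/-- The Bernoulli law on `Bool`. -/
def bern (p : unitInterval) : Measure Bool :=
  ENNReal.ofReal p • Measure.dirac true + ENNReal.ofReal (1 - p) • Measure.dirac false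

instance isProbabilityMeasure_bern (p : unitInterval) : IsProbabilityMeasure (bern p) := by
  constructor
  simp only [bern, Measure.add_apply, Measure.smul_apply, measure_univ, smul_eq_mul, mul_one]
  rw [← ENNReal.ofReal_add p.2.1 (by linarith [p.2.2])]
  simp

theorem bern_real_true (p : unitInterval) : (bern p).real {true} = p := by
  rw [measureReal_def]
  simp [bern, ENNReal.toReal_ofReal p.2.1]

theorem bern_real_false (p : unitInterval) : (bern p).real {false} = 1 - p := by
  rw [measureReal_def]
  simp [bern, ENNReal.toReal_ofReal (sub_nonneg.2 p.2.2)]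

theorem bern_real_singleton (p : unitInterval) (b : Bool) :
    (bern p).real {b} = if b then (p : ℝ) else 1 - p := by
  cases b <;> simp [bern_real_true, bern_real_false]

theorem eq_bern {μ : Measure Bool} [IsProbabilityMeasure μ] {p : unitInterval}
    (h : μ.real {true} = p) : μ = bern p := by
  have hf : μ.real {false} = 1 - p := by
    rw [← h, show ({false} : Set Bool) = {true}ᶜ by ext b; simp,
      probReal_compl_eq_one_sub (measurableSet_singleton _)]
  refine Measure.ext_of_singleton fun b => ?_
  rw [← measureReal_eq_measureReal_iff]
  cases b
  · rw [hf, bern_real_false]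
  · rw [h, bern_real_true]

/-- The product of Bernoulli laws of parameter `p`. -/
def berProd (p : unitInterval) : Measure (ℕ → Bool) := Measure.infinitePi fun _ => bern p

instance isProbabilityMeasure_berProd (p : unitInterval) : IsProbabilityMeasure (berProd p) := by
  unfold berProd; infer_instance

/-- The majority polynomial as a self-map of the unit interval. -/
def majI (n : ℕ) (p : unitInterval) : unitInterval := ⟨(majPoly n).eval p, majPoly_mem_Icc n p.2⟩

theorem sum_bool_functions_card {m : ℕ} (g : ℕ → ℝ) :
    ∑ f : Fin m → Bool, g (Finset.univ.filter fun k => f k = true).card =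
      ∑ k ∈ Finset.range (m + 1), (m.choose k : ℝ) * g k := by
  have h := Finset.sum_powerset_apply_card g (x := (Finset.univ : Finset (Fin m)))
  simp only [Finset.card_univ, Fintype.card_fin, nsmul_eq_mul] at h
  rw [← h]
  refine Finset.sum_bij' (fun f _ => Finset.univ.filter fun k => f k = true)
    (fun s _ k => decide (k ∈ s)) ?_ ?_ ?_ ?_ ?_ <;> simp

theorem map_majority_bern (n : ℕ) (p : unitInterval) :
    (Measure.infinitePi fun _ : Fin (2 * n + 1) => bern p).map
      (fun f => decide (n + 1 ≤ (Finset.univ.filter fun k => f k = true).card)) =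
      bern (majI n p) := by
  have hmeas : Measurable fun f : Fin (2 * n + 1) → Bool =>
      decide (n + 1 ≤ (Finset.univ.filter fun k => f k = true).card) := measurable_of_finite _
  have := Measure.isProbabilityMeasure_map (μ := Measure.infinitePi fun _ : Fin (2 * n + 1) =>
    bern p) hmeas.aemeasurable
  refine eq_bern ?_
  rw [map_measureReal_apply hmeas (measurableSet_singleton _),
    ← integral_indicator_one (hmeas (measurableSet_singleton _)),
    integral_fintype Integrable.of_finite]
  have hsing : ∀ f : Fin (2 * n + 1) → Bool,
      (Measure.infinitePi fun _ : Fin (2 * n + 1) => bern p).real {f} =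
        (p : ℝ) ^ (Finset.univ.filter fun k => f k = true).card *
          (1 - p) ^ (2 * n + 1 - (Finset.univ.filter fun k => f k = true).card) := by
    intro f
    have hc := Finset.card_filter_add_card_filter_not (s := Finset.univ) (fun k => f k = true)
    rw [Finset.card_univ, Fintype.card_fin] at hc
    rw [measureReal_def, Measure.infinitePi_singleton_of_fintype, ENNReal.toReal_prod]
    simp_rw [← measureReal_def, bern_real_singleton]
    rw [Finset.prod_ite, Finset.prod_const, Finset.prod_const]
    congr 2
    omega
  have hterm : ∀ f : Fin (2 * n + 1) → Bool,
      (Measure.infinitePi fun _ : Fin (2 * n + 1) => bern p).real {f} •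
        ((fun f : Fin (2 * n + 1) → Bool =>
          decide (n + 1 ≤ (Finset.univ.filter fun k => f k = true).card)) ⁻¹' {true}).indicator
          (1 : (Fin (2 * n + 1) → Bool) → ℝ) f =
      (fun k => if n + 1 ≤ k then (p : ℝ) ^ k * (1 - p) ^ (2 * n + 1 - k) else 0)
        (Finset.univ.filter fun k => f k = true).card := by
    intro f
    rw [hsing]
    by_cases h : n + 1 ≤ (Finset.univ.filter fun k => f k = true).card
    · rw [Set.indicator_of_mem (by simpa using h)]
      simp [h]
    · rw [Set.indicator_of_notMem (by simpa using h)]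
      simp [h]
  rw [Finset.sum_congr rfl fun f _ => hterm f]
  refine (sum_bool_functions_card (m := 2 * n + 1)
    fun k => if n + 1 ≤ k then (p : ℝ) ^ k * (1 - p) ^ (2 * n + 1 - k) else 0).trans ?_
  rw [show 2 * n + 1 + 1 = (n + 1) + (n + 1) by ring, Finset.sum_range_add]
  rw [Finset.sum_eq_zero, zero_add, majI]
  · simp only [majPoly, Polynomial.eval_finsetSum]
    refine Finset.sum_congr rfl fun k _ => ?_
    rw [if_pos (by omega)]
    simp [bernsteinPolynomial]
    ring
  · intro k hk
    rw [Finset.mem_range] at hk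
    rw [if_neg (by omega), mul_zero]

theorem blockMaj_eq (n i : ℕ) (y : ℕ → Bool) :
    blockMaj n i y = decide (n + 1 ≤
      (Finset.univ.filter fun k : Fin (2 * n + 1) => y ((2 * n + 1) * i + 1 + k) = true).card) := by
  unfold blockMaj
  congr 2
  symm
  refine Finset.card_bij (fun k _ => (2 * n + 1) * i + 1 + k) ?_ ?_ ?_
  · intro k hk
    simp only [Finset.mem_filter, Finset.mem_univ, true_and] at hk
    simp only [block, Finset.mem_filter, Finset.mem_Icc]
    exact ⟨by omega, hk⟩
  · intro a _ b _ hab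
    ext
    omega
  · intro j hj
    simp only [block, Finset.mem_filter, Finset.mem_Icc] at hj
    refine ⟨⟨j - ((2 * n + 1) * i + 1), by omega⟩, ?_, ?_⟩
    · simp only [Finset.mem_filter, Finset.mem_univ, true_and]
      rw [show (2 * n + 1) * i + 1 + (j - ((2 * n + 1) * i + 1)) = j by omega]
      exact hj.2
    · simp only
      omega

theorem measurable_maj (n : ℕ) : Measurable (maj n) := (maj n).continuous.measurable

/-- The blocks are disjoint, so the majority map sends product Bernoulli laws to product
Bernoulli laws. -/
theorem map_maj_berProd (n : ℕ) (p : unitInterval) : (berProd p).map (maj n) = berProd (majI n p) := by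
  -- `σ` enumerates the blocks. Being injective, it turns the product law over cells into a product
  -- over blocks of product laws.
  let σ : ℕ × Fin (2 * n + 1) → ℕ := fun q => (2 * n + 1) * q.1 + 1 + q.2
  have hσ : Function.Injective σ := by
    rintro ⟨i, k⟩ ⟨j, l⟩ h
    simp only [σ] at h
    have hi : i = j := by
      have h1 := congrArg (fun m => (m - 1) / (2 * n + 1)) h
      simp only [show ∀ a b : ℕ, a + 1 + b - 1 = b + a by omega] at h1
      rwa [Nat.add_mul_div_left _ _ (by omega), Nat.add_mul_div_left _ _ (by omega),
        Nat.div_eq_of_lt k.2, Nat.div_eq_of_lt l.2, zero_add, zero_add] at h1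
    subst hi
    refine Prod.ext rfl (Fin.ext ?_)
    simp only
    omega
  have h1 := Measure.map_infinitePi_infinitePi_of_inj (P := fun _ => bern p) hσ
  have h2 := Measure.infinitePi_map_curry fun (_ : ℕ) (_ : Fin (2 * n + 1)) => bern p
  have hmeas : Measurable fun f : Fin (2 * n + 1) → Bool =>
      decide (n + 1 ≤ (Finset.univ.filter fun k => f k = true).card) := measurable_of_finite _
  have h3 := Measure.infinitePi_map_pi
    (fun _ : ℕ => Measure.infinitePi fun _ : Fin (2 * n + 1) => bern p)
    (f := fun _ f => decide (n + 1 ≤ (Finset.univ.filter fun k => f k = true).card))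
    (fun _ => hmeas)
  simp only [map_majority_bern] at h3
  have hpi : Measurable fun (x : ℕ → Fin (2 * n + 1) → Bool) i =>
      decide (n + 1 ≤ (Finset.univ.filter fun k => x i k = true).card) :=
    measurable_pi_iff.2 fun i => hmeas.comp (measurable_pi_apply i)
  have hcurry := (MeasurableEquiv.curry ℕ (Fin (2 * n + 1)) Bool).measurable
  rw [berProd, berProd, ← h3, ← h2, ← h1, Measure.map_map hpi hcurry,
    Measure.map_map (hpi.comp hcurry) (by fun_prop)]
  congr 1
  ext y i
  exact blockMaj_eq n i y

/-- The effect of the noise on the parameter of a Bernoulli law. -/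
def noiseI (ε p : unitInterval) : unitInterval :=
  ⟨(1 - ε) * p + ε / 2, noise_mem_Icc ε.2 p.2⟩

theorem noisyCell_bool_real_true (ε : unitInterval) (b : Bool) :
    (noisyCell ε b).real {true} = (1 - ε) * (if b then 1 else 0) + ε / 2 := by
  rw [measureReal_def, noisyCell_singleton, ENNReal.toReal_ofReal]
  · cases b <;> simp
  · have h1 : (0 : ℝ) ≤ 1 - ε := by linarith [ε.2.2]
    have h2 : (0 : ℝ) ≤ ε := ε.2.1
    split_ifs <;> positivity

theorem bern_bind_noisyCell (ε p : unitInterval) :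
    (bern p).bind (noisyCell ε) = bern (noiseI ε p) := by
  have hm : Measurable (noisyCell (A := Bool) ε) := measurable_of_finite _
  have : IsProbabilityMeasure ((bern p).bind (noisyCell ε)) :=
    isProbabilityMeasure_bind hm.aemeasurable (ae_of_all _ fun b => inferInstance)
  refine eq_bern ?_
  rw [measureReal_def, Measure.bind_apply (measurableSet_singleton _) hm.aemeasurable,
    ← integral_toReal (measurable_of_finite _).aemeasurable (ae_of_all _ fun b => measure_lt_top _ _)]
  simp_rw [← measureReal_def, noisyCell_bool_real_true]
  rw [integral_fintype Integrable.of_finite]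
  simp only [Fintype.univ_bool, Finset.mem_singleton, Bool.true_eq_false, not_false_eq_true,
    Finset.sum_insert, Finset.sum_singleton, bern_real_true, bern_real_false, smul_eq_mul, noiseI]
  simp
  ring

theorem lintegral_prod_infinitePi {A : Type*} [MeasurableSpace A] (μ : Measure A)
    [IsProbabilityMeasure μ] (s : Finset ℕ) (f : ℕ → A → ENNReal) (hf : ∀ i, Measurable (f i)) :
    ∫⁻ x, ∏ i ∈ s, f i (x i) ∂(Measure.infinitePi fun _ : ℕ => μ) =
      ∏ i ∈ s, ∫⁻ a, f i a ∂μ := by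
  have h := lintegral_prod_eq_prod_lintegral_of_indepFun (μ := Measure.infinitePi fun _ : ℕ => μ)
    s (fun i x => f i (x i)) (iIndepFun_infinitePi (P := fun _ => μ) hf)
    (fun i => (hf i).comp (measurable_pi_apply i))
  rw [h]
  refine Finset.prod_congr rfl fun i _ => ?_
  have he := Measure.infinitePi_map_eval (fun _ : ℕ => μ) i
  rw [← lintegral_map (hf i) (measurable_pi_apply i), he]

/-- Independent noise on every cell sends product Bernoulli laws to product Bernoulli laws. -/
theorem act_id_berProd (ε p : unitInterval) :
    act (ContinuousMap.id _) ε (berProd p) = berProd (noiseI ε p) := by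
  refine Measure.eq_infinitePi _ fun s t ht => ?_
  have hm : ∀ i, Measurable fun b : Bool => noisyCell ε b (t i) := fun i => measurable_of_finite _
  have hc : Measurable (noisyCell (A := Bool) ε) := measurable_of_finite _
  rw [act, Measure.bind_apply (.pi s.countable_toSet fun _ _ => ht _) (Kernel.aemeasurable _)]
  simp only [perturbation_apply, ContinuousMap.id_apply]
  simp_rw [Measure.infinitePi_pi (fun i => noisyCell ε _) (fun i _ => ht i)]
  refine (lintegral_prod_infinitePi (bern p) s (fun i b => noisyCell ε b (t i)) hm).trans ?_
  refine Finset.prod_congr rfl fun i _ => ?_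
  rw [← bern_bind_noisyCell, Measure.bind_apply (ht i) hc.aemeasurable]

/-- The kernel is majority followed by noise, whereas `majOp` and `meanField` take these two halves
in the opposite order; hence the extra `noiseI` when a fixed point is turned into an invariant law.
-/
theorem act_maj (n : ℕ) (ε : unitInterval) (μ : Measure (ℕ → Bool)) :
    act (maj n) ε μ = act (ContinuousMap.id _) ε (μ.map (maj n)) := by
  refine Measure.ext fun s hs => ?_
  rw [act, act, Measure.bind_apply hs (Kernel.aemeasurable _),
    Measure.bind_apply hs (Kernel.aemeasurable _),
    lintegral_map (Kernel.measurable_coe _ hs) (measurable_maj n)]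
  rfl

theorem act_maj_berProd (n : ℕ) (ε p : unitInterval) :
    act (maj n) ε (berProd p) = berProd (noiseI ε (majI n p)) := by
  rw [act_maj, map_maj_berProd, act_id_berProd]

theorem berProd_real_true (p : unitInterval) (i : ℕ) :
    ∫ u, (if u i = true then (1 : ℝ) else 0) ∂(berProd p) = p := by
  have h := integral_map (μ := berProd p) (measurable_pi_apply i).aemeasurable
    (f := fun b : Bool => if b = true then (1 : ℝ) else 0)
    (measurable_of_finite _).aestronglyMeasurable
  rw [← h, berProd, Measure.infinitePi_map_eval, integral_fintype Integrable.of_finite]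
  simp [bern_real_true]

theorem berProd_injective : Function.Injective berProd := fun p q h => by
  have := berProd_real_true p 0
  rw [h, berProd_real_true] at this
  exact Subtype.ext this.symm

/-- If the mean-field recursion has a fixed point below `1/2`, the noisy majority map has several
invariant measures. -/
theorem noLowFixedPoint_of_mem_uni {n : ℕ} {ε : unitInterval} (h1 : (ε : ℝ) < 1)
    (h : ε ∈ uni (maj n)) : NoLowFixedPoint n ε := by
  obtain ⟨π, hπ⟩ := h
  intro p hp hfix
  have hinv : ∀ q : unitInterval, meanField n ε q = q → berProd (noiseI ε q) = π := by
    intro q hq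
    have : berProd (noiseI ε q) ∈ invariantMeasures (maj n) ε := by
      refine ⟨inferInstance, ?_⟩
      rw [act_maj_berProd]
      congr 2
      exact Subtype.ext hq
    rwa [hπ] at this
  have e1 := hinv ⟨p, hp.1, by linarith [hp.2]⟩ hfix
  have e2 := hinv ⟨1 / 2, by norm_num, by norm_num⟩ (meanField_half n ε)
  have e3 := congrArg Subtype.val (berProd_injective (e1.trans e2.symm))
  simp only [noiseI] at e3
  have := hp.2
  nlinarith

/-! ### The noisy majority operator -/

/-- Noise followed by the majority map, as an operator on functions. -/
def majOp (n : ℕ) (ε : unitInterval) (G : (ℕ → Bool) → ℝ) : (ℕ → Bool) → ℝ :=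
  markovOp (ContinuousMap.id _) ε fun y => G (maj n y)

theorem BddMeas.comp_maj {G : (ℕ → Bool) → ℝ} (hG : BddMeas G) (n : ℕ) :
    BddMeas fun y => G (maj n y) :=
  ⟨hG.1.comp (measurable_maj n), hG.2.imp fun _ h _ => h _⟩

theorem BddMeas.majOp {G : (ℕ → Bool) → ℝ} (hG : BddMeas G) (n : ℕ) (ε : unitInterval) :
    BddMeas (majOp n ε G) := (hG.comp_maj n).markovOp _ ε

/-- The mean-field recursion on the unit interval. -/
def meanI (n : ℕ) (ε p : unitInterval) : unitInterval := majI n (noiseI ε p)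

theorem coe_iterate_meanI (n : ℕ) (ε p : unitInterval) (s : ℕ) :
    (((meanI n ε)^[s] p : unitInterval) : ℝ) = (meanField n ε)^[s] p := by
  induction s generalizing p with
  | zero => rfl
  | succ s ih => rw [Function.iterate_succ_apply, ih, Function.iterate_succ_apply]; rfl

theorem integral_iterate_majOp (n : ℕ) (ε p : unitInterval) {G : (ℕ → Bool) → ℝ} (hG : BddMeas G)
    (s : ℕ) : ∫ u, (majOp n ε)^[s] G u ∂(berProd p) =
      ∫ u, G u ∂(berProd ((meanI n ε)^[s] p)) := by
  induction s generalizing G with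
  | zero => rfl
  | succ s ih =>
    rw [Function.iterate_succ_apply, ih (hG.majOp n ε), majOp,
      ← integral_act _ _ _ (hG.comp_maj n), act_id_berProd,
      ← integral_map (φ := maj n) (f := G) (measurable_maj n).aemeasurable
        hG.1.aestronglyMeasurable, map_maj_berProd, Function.iterate_succ_apply']
    rfl

/-- Constant configurations are extreme Bernoulli laws, so iterates of `majOp` at them are computed
by the mean-field orbits of `0` and `1`. -/
theorem berProd_zero : berProd 0 = Measure.dirac fun _ => false := by
  rw [berProd, show bern 0 = Measure.dirac false by simp [bern]]
  exact Measure.infinitePi_dirac _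

theorem berProd_one : berProd 1 = Measure.dirac fun _ => true := by
  rw [berProd, show bern 1 = Measure.dirac true by simp [bern]]
  exact Measure.infinitePi_dirac _

/-! ### Noise as a random source -/

/-- The law of the noise at one cell with alphabet `Bool × Bool`: a flag telling whether the symbol
is replaced, and the new symbol. -/
def cellNoise (ε : unitInterval) : Measure (Bool × Bool × Bool) :=
  ENNReal.ofReal (1 - ε) • Measure.dirac (false, false, false) +
    ENNReal.ofReal ε • (uniformOn (Set.univ : Set (Bool × Bool))).map (Prod.mk true)

instance isProbabilityMeasure_cellNoise (ε : unitInterval) :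
    IsProbabilityMeasure (cellNoise ε) := by
  have : IsProbabilityMeasure
      ((uniformOn (Set.univ : Set (Bool × Bool))).map (Prod.mk true)) :=
    Measure.isProbabilityMeasure_map (measurable_of_finite _).aemeasurable
  constructor
  simp only [cellNoise, Measure.add_apply, Measure.smul_apply, measure_univ, smul_eq_mul, mul_one]
  rw [← ENNReal.ofReal_add (by linarith [ε.2.2]) ε.2.1]
  simp

/-- The law of the noise on all cells. -/
def noise (ε : unitInterval) : Measure (ℕ → Bool × Bool × Bool) :=
  Measure.infinitePi fun _ => cellNoise ε

instance isProbabilityMeasure_noise (ε : unitInterval) : IsProbabilityMeasure (noise ε) := by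
  unfold noise; infer_instance

/-- The noisy copy of the symbol `(b, 0)`. -/
def noisySymbol (b : Bool) (z : Bool × Bool × Bool) : Bool × Bool :=
  if z.1 then z.2 else (b, false)

/-- The noisy copy of the configuration `(u, 0)`. -/
def noisyCopy (u : ℕ → Bool) (ξ : ℕ → Bool × Bool × Bool) (i : ℕ) : Bool × Bool :=
  noisySymbol (u i) (ξ i)

theorem map_noisySymbol (ε : unitInterval) (b : Bool) :
    (cellNoise ε).map (noisySymbol b) = noisyCell ε (b, false) := by
  have hm : Measurable (noisySymbol b) := measurable_of_finite _
  have hp : Measurable (Prod.mk true : Bool × Bool → Bool × Bool × Bool) := measurable_of_finite _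
  rw [cellNoise, Measure.map_add _ _ hm, Measure.map_smul, Measure.map_smul,
    Measure.map_dirac' hm, Measure.map_map hm hp]
  have : noisySymbol b ∘ Prod.mk true = id := by ext z <;> simp [noisySymbol]
  rw [this, Measure.map_id]
  simp [noisySymbol, noisyCell]

theorem noisyCell_pair_real (ε : unitInterval) (b : Bool) (a : Bool × Bool) :
    (noisyCell ε (b, false)).real {a} =
      (1 - ε) * (if a = (b, false) then 1 else 0) + ε / 4 := by
  rw [measureReal_def, noisyCell_singleton, ENNReal.toReal_ofReal]
  · simp
  · have h1 : (0 : ℝ) ≤ 1 - ε := by linarith [ε.2.2]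
    have h2 : (0 : ℝ) ≤ ε := ε.2.1
    split_ifs <;> positivity

theorem noisyCell_pair_real_set (ε : unitInterval) (b : Bool) (f : Bool × Bool → Bool) :
    (noisyCell ε (b, false)).real {a | f a = true} = ∑ a : Bool × Bool,
      ((1 - (ε : ℝ)) * (if a = (b, false) then 1 else 0) + ε / 4) *
        (if f a = true then 1 else 0) := by
  rw [← integral_indicator_one (Set.toFinite _).measurableSet, integral_fintype Integrable.of_finite]
  refine Finset.sum_congr rfl fun a _ => ?_
  rw [noisyCell_pair_real, smul_eq_mul]
  by_cases h : f a = true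
  · rw [Set.indicator_of_mem (by exact h), if_pos h]; rfl
  · rw [Set.indicator_of_notMem (by exact h), if_neg h]

theorem map_fst_noisyCell (ε : unitInterval) (b : Bool) :
    (noisyCell ε (b, false)).map Prod.fst = noisyCell ε b := by
  have hp : (1 - (ε : ℝ)) * (if b then 1 else 0) + ε / 2 ∈ Set.Icc (0 : ℝ) 1 := by
    obtain ⟨h0, h1⟩ := ε.2
    split_ifs <;> constructor <;> linarith
  have : IsProbabilityMeasure ((noisyCell ε (b, false)).map Prod.fst) :=
    Measure.isProbabilityMeasure_map measurable_fst.aemeasurable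
  rw [eq_bern (μ := noisyCell ε b) (p := ⟨_, hp⟩) (noisyCell_bool_real_true ε b)]
  refine eq_bern ?_
  rw [map_measureReal_apply measurable_fst (measurableSet_singleton _)]
  refine (noisyCell_pair_real_set ε b Prod.fst).trans ?_
  rw [Fintype.sum_prod_type]
  cases b <;> simp <;> ring_nf

theorem noisyCell_real_snd (ε : unitInterval) (b : Bool) :
    (noisyCell ε (b, false)).real {a | a.2 = true} = ε / 2 := by
  refine (noisyCell_pair_real_set ε b Prod.snd).trans ?_
  rw [Fintype.sum_prod_type]
  cases b <;> simp <;> ring_nf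

theorem measurable_noisyCopy (u : ℕ → Bool) : Measurable (noisyCopy u) :=
  measurable_pi_iff.2 fun i =>
    (measurable_of_finite (noisySymbol (u i))).comp (measurable_pi_apply i)

theorem map_noisyCopy (ε : unitInterval) (u : ℕ → Bool) :
    (noise ε).map (noisyCopy u) = Measure.infinitePi fun i => noisyCell ε (u i, false) := by
  have h := Measure.infinitePi_map_pi (fun _ : ℕ => cellNoise ε)
    (f := fun i => noisySymbol (u i)) (fun i => measurable_of_finite _)
  simp only [map_noisySymbol] at h
  exact h

/-- The first layer of a configuration. -/
def firstLayer (x : ℕ → Bool × Bool) (i : ℕ) : Bool := (x i).1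

theorem measurable_firstLayer : Measurable firstLayer :=
  measurable_pi_iff.2 fun i => measurable_fst.comp (measurable_pi_apply i)

theorem map_firstLayer_noisyCopy (ε : unitInterval) (u : ℕ → Bool) :
    (noise ε).map (fun ξ => firstLayer (noisyCopy u ξ)) =
      perturbation (ContinuousMap.id _) ε u := by
  have h := Measure.infinitePi_map_pi (fun i : ℕ => noisyCell ε (u i, false))
    (f := fun _ => Prod.fst) (fun _ => measurable_fst)
  simp only [map_fst_noisyCell] at h
  rw [perturbation_apply]
  simp only [ContinuousMap.id_apply]
  rw [← h, ← map_noisyCopy, Measure.map_map (by fun_prop) (measurable_noisyCopy u)]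
  rfl

/-- The right-hand side does not involve `u`: whether a cell resets is decided by the noise alone.
-/
theorem noisyCopy_snd (u : ℕ → Bool) (ξ : ℕ → Bool × Bool × Bool) (i : ℕ) :
    (noisyCopy u ξ i).2 = ((ξ i).1 && (ξ i).2.2) := by
  simp only [noisyCopy, noisySymbol]
  split_ifs with h <;> simp [h]

theorem firstLayer_noisyCopy (u : ℕ → Bool) (ξ : ℕ → Bool × Bool × Bool) (i : ℕ) :
    firstLayer (noisyCopy u ξ) i = if (ξ i).1 then (ξ i).2.1 else u i := by
  simp only [firstLayer, noisyCopy, noisySymbol]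
  split_ifs <;> rfl

/-! ### Local functions -/

/-- Functions with values in `[0, 1]` that depend only on the cells of `U`. -/
def IsLocal {A : Type*} (U : Finset ℕ) (G : (ℕ → A) → ℝ) : Prop :=
  DependsOn G (U : Set ℕ) ∧ ∀ u, G u ∈ Set.Icc (0 : ℝ) 1

theorem bddMeas_of_dependsOn {A : Type*} [Finite A] [MeasurableSpace A]
    [MeasurableSingletonClass A] {U : Finset ℕ} {G : (ℕ → A) → ℝ}
    (h : DependsOn G (U : Set ℕ)) : BddMeas G := by
  obtain ⟨g, rfl⟩ := dependsOn_iff_exists_comp.1 h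
  have : Finite ((i : (U : Set ℕ)) → A) := Pi.finite
  refine ⟨(measurable_of_finite g).comp (measurable_pi_iff.2 fun i => measurable_pi_apply _), ?_⟩
  obtain ⟨C, hC⟩ := (Set.finite_range fun a => |g a|).bddAbove
  exact ⟨C, fun x => hC ⟨_, rfl⟩⟩

theorem IsLocal.bddMeas {A : Type*} [Finite A] [MeasurableSpace A]
    [MeasurableSingletonClass A] {U : Finset ℕ} {G : (ℕ → A) → ℝ} (h : IsLocal U G) : BddMeas G :=
  bddMeas_of_dependsOn h.1

theorem IsLocal.abs_sub_le {A : Type*} {U : Finset ℕ} {G : (ℕ → A) → ℝ} (h : IsLocal U G)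
    (u v : ℕ → A) : |G u - G v| ≤ 1 := by
  obtain ⟨h0, h1⟩ := h.2 u
  obtain ⟨h2, h3⟩ := h.2 v
  rw [abs_le]
  constructor <;> linarith

theorem integral_mem_Icc {X : Type*} [MeasurableSpace X] (μ : Measure X) [IsProbabilityMeasure μ]
    {g : X → ℝ} (hg : BddMeas g) (h : ∀ x, g x ∈ Set.Icc (0 : ℝ) 1) :
    ∫ x, g x ∂μ ∈ Set.Icc (0 : ℝ) 1 := by
  refine ⟨integral_nonneg fun x => (h x).1, ?_⟩
  have := integral_mono (hg.integrable μ) (integrable_const (1 : ℝ)) fun x => (h x).2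
  simpa using this

/-! ### The operators of the perturbed majority maps on functions of the first layer -/

/-- The cells on which the majorities over the cells of `U` depend. -/
def children (n : ℕ) (U : Finset ℕ) : Finset ℕ := U.biUnion (block n)

/-- The first layer of the image under `majAux`. -/
def preImage (n : ℕ) (I : ℕ → Set ℝ) (E : ℕ → Finset ℕ) (x : ℕ → Bool × Bool) : ℕ → Bool :=
  firstLayer (majAux n I E x)

/-- The noise resets cell `i`. -/
def Resets (I : ℕ → Set ℝ) (E : ℕ → Finset ℕ) (i : ℕ) (ξ : ℕ → Bool × Bool × Bool) : Prop :=
  2 * freq (E i) (fun j => (ξ j).1 && (ξ j).2.2) ∈ I i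

/-- The random map on the first layer driven by the noise: noise, then `majAux`. -/
def auxStep (n : ℕ) (I : ℕ → Set ℝ) (E : ℕ → Finset ℕ) (u : ℕ → Bool)
    (ξ : ℕ → Bool × Bool × Bool) : ℕ → Bool :=
  preImage n I E (noisyCopy u ξ)

/-- The random map driven by the noise: noise, then the majority map. -/
def majStep (n : ℕ) (u : ℕ → Bool) (ξ : ℕ → Bool × Bool × Bool) : ℕ → Bool :=
  maj n (firstLayer (noisyCopy u ξ))

/-- The operator of `auxStep`. -/
def auxOp (n : ℕ) (I : ℕ → Set ℝ) (E : ℕ → Finset ℕ) (ε : unitInterval)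
    (G : (ℕ → Bool) → ℝ) (u : ℕ → Bool) : ℝ :=
  ∫ ξ, G (auxStep n I E u ξ) ∂(noise ε)

section

variable (n : ℕ) (I : ℕ → Set ℝ) (E : ℕ → Finset ℕ) (ε : unitInterval)

theorem measurable_preImage : Measurable (preImage n I E) :=
  measurable_firstLayer.comp (majAux n I E).continuous.measurable

theorem measurable_auxStep (u : ℕ → Bool) : Measurable (auxStep n I E u) :=
  (measurable_preImage n I E).comp (measurable_noisyCopy u)

theorem measurable_majStep (u : ℕ → Bool) : Measurable (majStep n u) :=
  (measurable_maj n).comp (measurable_firstLayer.comp (measurable_noisyCopy u))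

open Classical in
theorem auxStep_apply (u : ℕ → Bool) (ξ : ℕ → Bool × Bool × Bool) (i : ℕ) :
    auxStep n I E u ξ i = if Resets I E i ξ then false else majStep n u ξ i := by
  simp only [auxStep, preImage, firstLayer, majAux, ContinuousMap.coe_mk, noisyCopy_snd]
  by_cases h : Resets I E i ξ
  · rw [if_pos h, if_pos (by exact h)]
  · rw [if_neg h, if_neg (by exact h)]
    rfl

theorem majStep_congr {u v : ℕ → Bool} (ξ : ℕ → Bool × Bool × Bool) {i : ℕ}
    (h : ∀ j ∈ block n i, u j = v j) : majStep n u ξ i = majStep n v ξ i :=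
  blockMaj_congr n i fun j hj => by rw [firstLayer_noisyCopy, firstLayer_noisyCopy, h j hj]

theorem auxStep_congr {u v : ℕ → Bool} (ξ : ℕ → Bool × Bool × Bool) {i : ℕ}
    (h : ∀ j ∈ block n i, u j = v j) : auxStep n I E u ξ i = auxStep n I E v ξ i := by
  rw [auxStep_apply, auxStep_apply, majStep_congr n ξ h]

theorem bddMeas_comp {X Y : Type*} [MeasurableSpace X] [MeasurableSpace Y] {g : Y → ℝ}
    (hg : BddMeas g) {f : X → Y} (hf : Measurable f) : BddMeas fun x => g (f x) :=
  ⟨hg.1.comp hf, hg.2.imp fun _ h _ => h _⟩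

theorem majOp_eq {G : (ℕ → Bool) → ℝ} (hG : BddMeas G) (u : ℕ → Bool) :
    majOp n ε G u = ∫ ξ, G (majStep n u ξ) ∂(noise ε) := by
  rw [majOp, markovOp, ← map_firstLayer_noisyCopy, integral_map]
  · rfl
  · exact (measurable_firstLayer.comp (measurable_noisyCopy u)).aemeasurable
  · exact (hG.comp_maj n).1.aestronglyMeasurable

theorem IsLocal.auxOp {U : Finset ℕ} {G : (ℕ → Bool) → ℝ} (hG : IsLocal U G) :
    IsLocal (children n U) (auxOp n I E ε G) := by
  refine ⟨fun u v h => ?_, fun u => integral_mem_Icc _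
    (bddMeas_comp hG.bddMeas (measurable_auxStep n I E u)) fun ξ => hG.2 _⟩
  refine integral_congr_ae (ae_of_all _ fun ξ => hG.1 fun i hi => ?_)
  exact auxStep_congr n I E ξ fun j hj => h j (Finset.mem_biUnion.2 ⟨i, hi, hj⟩)

theorem IsLocal.majOp {U : Finset ℕ} {G : (ℕ → Bool) → ℝ} (hG : IsLocal U G) :
    IsLocal (children n U) (majOp n ε G) := by
  have e : NoisyMajority.majOp n ε G = fun u => ∫ ξ, G (majStep n u ξ) ∂(noise ε) :=
    funext (majOp_eq n ε hG.bddMeas)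
  rw [e]
  refine ⟨fun u v h => ?_, fun u => integral_mem_Icc _
    (bddMeas_comp hG.bddMeas (measurable_majStep n u)) fun ξ => hG.2 _⟩
  refine integral_congr_ae (ae_of_all _ fun ξ => hG.1 fun i hi => ?_)
  exact majStep_congr n ξ fun j hj => h j (Finset.mem_biUnion.2 ⟨i, hi, hj⟩)

theorem IsLocal.iterate_auxOp {U : Finset ℕ} {G : (ℕ → Bool) → ℝ} (hG : IsLocal U G) (k : ℕ) :
    IsLocal ((children n)^[k] U) ((NoisyMajority.auxOp n I E ε)^[k] G) := by
  induction k with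
  | zero => exact hG
  | succ k ih =>
    rw [Function.iterate_succ_apply', Function.iterate_succ_apply']
    exact ih.auxOp n I E ε

theorem abs_auxOp_sub_le {G H : (ℕ → Bool) → ℝ} (hG : BddMeas G) (hH : BddMeas H) {C : ℝ}
    (h : ∀ u, |G u - H u| ≤ C) (u : ℕ → Bool) :
    |auxOp n I E ε G u - auxOp n I E ε H u| ≤ C := by
  rw [auxOp, auxOp, ← integral_sub
    ((bddMeas_comp hG (measurable_auxStep n I E u)).integrable _)
    ((bddMeas_comp hH (measurable_auxStep n I E u)).integrable _)]
  exact abs_integral_le_of_forall _ fun ξ => h _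

theorem abs_iterate_auxOp_sub_le {U V : Finset ℕ} {G H : (ℕ → Bool) → ℝ} (hG : IsLocal U G)
    (hH : IsLocal V H) {C : ℝ} (h : ∀ u, |G u - H u| ≤ C) (t : ℕ) (u : ℕ → Bool) :
    |(auxOp n I E ε)^[t] G u - (auxOp n I E ε)^[t] H u| ≤ C := by
  induction t generalizing u with
  | zero => exact h u
  | succ t ih =>
    rw [Function.iterate_succ_apply', Function.iterate_succ_apply']
    exact abs_auxOp_sub_le n I E ε (hG.iterate_auxOp n I E ε t).bddMeas
      (hH.iterate_auxOp n I E ε t).bddMeas ih u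

/-! ### Comparison with the unperturbed operators -/

theorem measurableSet_resets (i : ℕ) : MeasurableSet {ξ | Resets I E i ξ} := by
  classical
  have h : DependsOn (fun ξ : ℕ → Bool × Bool × Bool => if Resets I E i ξ then (1 : ℝ) else 0)
      (E i : Set ℕ) := fun ξ ξ' hξ => by
    have : Resets I E i ξ ↔ Resets I E i ξ' := by
      unfold Resets
      rw [freq_congr (E i) fun j hj => by rw [hξ j hj]]
    simp only [this]
  have h' := (bddMeas_of_dependsOn h).1 (measurableSet_singleton 1)
  convert h' using 1
  ext ξ
  simp

/-- A coupling with a union bound: both maps are driven by the same noise, `G` oscillates by at most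
`1`, and its two values agree outside the events `B i`, `i ∈ U`. -/
theorem abs_integral_sub_le_sum {U : Finset ℕ} {G : (ℕ → Bool) → ℝ} (hG : IsLocal U G)
    {f g : (ℕ → Bool × Bool × Bool) → ℕ → Bool} (hf : Measurable f) (hg : Measurable g)
    {B : ℕ → Set (ℕ → Bool × Bool × Bool)} (hB : ∀ i, MeasurableSet (B i))
    (h : ∀ i ∈ U, ∀ ξ ∉ B i, f ξ i = g ξ i) :
    |∫ ξ, G (f ξ) ∂(noise ε) - ∫ ξ, G (g ξ) ∂(noise ε)| ≤ ∑ i ∈ U, (noise ε).real (B i) := by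
  have hfi := (bddMeas_comp hG.bddMeas hf).integrable (noise ε)
  have hgi := (bddMeas_comp hG.bddMeas hg).integrable (noise ε)
  have hBi : ∀ i ∈ U, Integrable ((B i).indicator (1 : (ℕ → Bool × Bool × Bool) → ℝ)) (noise ε) := fun i _ =>
    (integrable_const (1 : ℝ)).indicator (hB i)
  rw [← integral_sub hfi hgi]
  refine (abs_integral_le_integral_abs).trans ?_
  have hsum : ∑ i ∈ U, (noise ε).real (B i) =
      ∫ ξ, ∑ i ∈ U, (B i).indicator (1 : (ℕ → Bool × Bool × Bool) → ℝ) ξ ∂(noise ε) := by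
    rw [integral_finsetSum _ hBi]
    exact Finset.sum_congr rfl fun i _ => (integral_indicator_one (hB i)).symm
  rw [hsum]
  refine integral_mono (hfi.sub hgi).abs (integrable_finsetSum _ hBi) fun ξ => ?_
  have hnn : ∀ i ∈ U, 0 ≤ (B i).indicator (1 : (ℕ → Bool × Bool × Bool) → ℝ) ξ := fun i _ =>
    Set.indicator_nonneg (fun _ _ => zero_le_one) _
  by_cases hξ : ∃ i ∈ U, ξ ∈ B i
  · obtain ⟨i, hi, hiB⟩ := hξ
    refine (hG.abs_sub_le _ _).trans ?_
    have := Finset.single_le_sum hnn hi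
    rwa [Set.indicator_of_mem hiB] at this
  · push Not at hξ
    have : G (f ξ) = G (g ξ) := hG.1 fun i hi => h i hi ξ (hξ i hi)
    simp only [this, sub_self, abs_zero]
    exact Finset.sum_nonneg hnn

theorem abs_auxOp_sub_majOp_le {U : Finset ℕ} {G : (ℕ → Bool) → ℝ} (hG : IsLocal U G)
    (u : ℕ → Bool) : |auxOp n I E ε G u - majOp n ε G u| ≤
      ∑ i ∈ U, (noise ε).real {ξ | Resets I E i ξ} := by
  rw [majOp_eq n ε hG.bddMeas]
  refine abs_integral_sub_le_sum ε hG (measurable_auxStep n I E u) (measurable_majStep n u)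
    (measurableSet_resets I E) fun i _ ξ hξ => ?_
  rw [auxStep_apply, if_neg (by exact hξ)]

theorem abs_auxOp_sub_const_le {U : Finset ℕ} {G : (ℕ → Bool) → ℝ} (hG : IsLocal U G)
    (u : ℕ → Bool) : |auxOp n I E ε G u - G fun _ => false| ≤
      ∑ i ∈ U, (noise ε).real {ξ | Resets I E i ξ}ᶜ := by
  have h := abs_integral_sub_le_sum ε hG (measurable_auxStep n I E u)
    (g := fun _ _ => false) measurable_const
    (fun i => (measurableSet_resets I E i).compl) fun i _ ξ hξ => by
      rw [auxStep_apply, if_pos (by simpa using hξ)]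
  simpa [auxOp] using h

/-! ### Propagation of errors along the tree of blocks -/

/-- A weight that decreases fast enough along the tree of blocks. -/
def weight (n i : ℕ) : ℝ := (1 / (2 * (2 * n + 1))) ^ i

theorem weight_pos (i : ℕ) : 0 < weight n i := by unfold weight; positivity

/-- The block has `2n+1` cells, all of index at least `i + 1` thanks to the offset `1` in `block`,
and one index step divides the weight by `2(2n+1)`. -/
theorem sum_weight_block_le (i : ℕ) : ∑ j ∈ block n i, weight n j ≤ weight n i / 2 := by
  have hN : (0 : ℝ) < 2 * n + 1 := by positivity
  have hle : ∀ j ∈ block n i, weight n j ≤ weight n (i + 1) := fun j hj => by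
    rw [block, Finset.mem_Icc] at hj
    refine pow_le_pow_of_le_one (by positivity) ?_ (by nlinarith [hj.1])
    rw [div_le_one (by positivity)]
    have : (0 : ℝ) ≤ n := Nat.cast_nonneg n
    linarith
  refine (Finset.sum_le_card_nsmul _ _ _ hle).trans ?_
  have hc : (block n i).card = 2 * n + 1 := by simp [block]
  rw [hc, nsmul_eq_mul, weight, weight, pow_succ]
  push_cast
  field_simp
  exact le_rfl

theorem sum_biUnion_le {ι κ : Type*} [DecidableEq κ] (U : Finset ι) (B : ι → Finset κ)
    {f : κ → ℝ} (hf : ∀ i, 0 ≤ f i) :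
    ∑ j ∈ U.biUnion B, f j ≤ ∑ i ∈ U, ∑ j ∈ B i, f j := by
  classical
  induction U using Finset.induction_on with
  | empty => simp
  | insert a s ha ih =>
    rw [Finset.biUnion_insert, Finset.sum_insert ha]
    have h := Finset.sum_union_inter (s₁ := B a) (s₂ := s.biUnion B) (f := f)
    have h' : 0 ≤ ∑ j ∈ B a ∩ s.biUnion B, f j := Finset.sum_nonneg fun i _ => hf i
    linarith

/-- The total weight of a finite set of cells. -/
def totalWeight (n : ℕ) (U : Finset ℕ) : ℝ := ∑ i ∈ U, weight n i

theorem totalWeight_children_le (U : Finset ℕ) :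
    totalWeight n (children n U) ≤ totalWeight n U / 2 := by
  rw [totalWeight, totalWeight, Finset.sum_div]
  exact (sum_biUnion_le U (block n) fun i => (weight_pos n i).le).trans
    (Finset.sum_le_sum fun i _ => sum_weight_block_le n i)

theorem totalWeight_iterate_children_le (U : Finset ℕ) (k : ℕ) :
    totalWeight n ((children n)^[k] U) ≤ totalWeight n U * (1 / 2) ^ k := by
  induction k with
  | zero => simp
  | succ k ih =>
    rw [Function.iterate_succ_apply', pow_succ]
    linarith [totalWeight_children_le n ((children n)^[k] U)]

/-- If resets are rare, the perturbed operator stays close to the unperturbed one at all times. -/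
theorem abs_iterate_auxOp_sub_iterate_majOp_le
    (hr : ∀ i, (noise ε).real {ξ | Resets I E i ξ} ≤ weight n i) (t : ℕ) {U : Finset ℕ}
    {G : (ℕ → Bool) → ℝ} (hG : IsLocal U G) (u : ℕ → Bool) :
    |(auxOp n I E ε)^[t] G u - (majOp n ε)^[t] G u| ≤ 2 * totalWeight n U := by
  induction t generalizing U G with
  | zero =>
    simp only [Function.iterate_zero, id_eq, sub_self, abs_zero]
    exact mul_nonneg two_pos.le (Finset.sum_nonneg fun i _ => (weight_pos n i).le)
  | succ t ih =>
    rw [Function.iterate_succ_apply, Function.iterate_succ_apply]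
    -- Only the operator applied first to `G` is exchanged here, at cost `totalWeight n U`. The
    -- other steps act on a function of the children, whose total weight is at most half, so the
    -- geometric series gives the factor `2`.
    have h1 := abs_iterate_auxOp_sub_le n I E ε (hG.auxOp n I E ε) (hG.majOp n ε)
      (C := totalWeight n U) (fun v => (abs_auxOp_sub_majOp_le n I E ε hG v).trans
        (Finset.sum_le_sum fun i _ => hr i)) t u
    have h2 := ih (hG.majOp n ε)
    have h3 := totalWeight_children_le n U
    have h4 := abs_sub_le ((auxOp n I E ε)^[t] (auxOp n I E ε G) u)
      ((auxOp n I E ε)^[t] (majOp n ε G) u) ((majOp n ε)^[t] (majOp n ε G) u)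
    linarith

end

/-! ### Concentration of the frequency of the symbol `1` on the second layer -/

theorem cellNoise_real_flag (ε : unitInterval) :
    (cellNoise ε).real {z | (z.1 && z.2.2) = true} = ε / 2 := by
  have hm : Measurable (noisySymbol false) := measurable_of_finite _
  rw [← noisyCell_real_snd ε false, ← map_noisySymbol,
    map_measureReal_apply hm (Set.toFinite _).measurableSet]
  congr 1
  ext ⟨a, b, c⟩
  cases a <;> simp [noisySymbol]

/-- Chebyshev for a sum of independent indicators, each of variance at most `1/2`; a deviation `d`
of twice the frequency is a deviation `d * S.card / 2` of the sum. -/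
theorem noise_real_deviation_le (ε : unitInterval) {S : Finset ℕ} (hS : S.Nonempty) {d : ℝ}
    (hd : 0 < d) :
    (noise ε).real {ξ | d ≤ |2 * freq S (fun j => (ξ j).1 && (ξ j).2.2) - ε|} ≤
      2 / (d ^ 2 * S.card) := by
  let f : Bool × Bool × Bool → ℝ := fun z => if (z.1 && z.2.2) = true then 1 else 0
  let ζ : ℕ → (ℕ → Bool × Bool × Bool) → ℝ := fun j ξ => f (ξ j)
  have hf : Measurable f := measurable_of_finite _
  have hζm : ∀ j, Measurable (ζ j) := fun j => hf.comp (measurable_pi_apply j)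
  have hζb : ∀ j ξ, ζ j ξ ∈ Set.Icc (0 : ℝ) 1 := fun j ξ => by
    simp only [ζ, f]
    split_ifs <;> simp
  have hζL : ∀ j, MemLp (ζ j) 2 (noise ε) := fun j =>
    MemLp.of_bound (hζm j).aestronglyMeasurable 1 (ae_of_all _ fun ξ => by
      rw [Real.norm_of_nonneg (hζb j ξ).1]; exact (hζb j ξ).2)
  have hfi : ∫ z, f z ∂(cellNoise ε) = ε / 2 := by
    rw [← cellNoise_real_flag, ← integral_indicator_one (Set.toFinite _).measurableSet]
    congr 1
    ext z
    simp only [f, Set.indicator_apply, Set.mem_ofPred_eq, Pi.one_apply]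
  have hint : ∀ j, ∫ ξ, ζ j ξ ∂(noise ε) = ε / 2 := fun j => by
    have he := Measure.infinitePi_map_eval (fun _ : ℕ => cellNoise ε) j
    have := integral_map (μ := noise ε) (φ := fun ξ => ξ j) (f := f)
      (measurable_pi_apply j).aemeasurable hf.aestronglyMeasurable
    rw [← this, ← hfi]
    congr 1
  have hind : iIndepFun ζ (noise ε) :=
    iIndepFun_infinitePi (P := fun _ => cellNoise ε) (X := fun _ => f) fun _ => hf
  have hvar1 : ∀ j, variance (ζ j) (noise ε) ≤ 1 / 2 := fun j => by
    refine (variance_le_expectation_sq (hζm j).aestronglyMeasurable).trans ?_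
    have hsq : ζ j ^ 2 = ζ j := by
      ext ξ
      simp only [Pi.pow_apply, ζ, f]
      split_ifs <;> simp
    rw [hsq, hint]
    linarith [ε.2.2]
  have hvar : variance (∑ j ∈ S, ζ j) (noise ε) ≤ S.card / 2 := by
    rw [IndepFun.variance_sum (fun j _ => hζL j) fun i _ j _ hij => hind.indepFun hij]
    refine (Finset.sum_le_card_nsmul _ _ _ fun j _ => hvar1 j).trans ?_
    rw [nsmul_eq_mul]
    linarith
  have hc : (0 : ℝ) < S.card := by exact_mod_cast hS.card_pos
  have hmean : ∫ ξ, (∑ j ∈ S, ζ j) ξ ∂(noise ε) = S.card * (ε / 2) := by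
    simp only [Finset.sum_apply]
    rw [integral_finsetSum _ fun j _ => (hζL j).integrable (by norm_num)]
    simp [hint]
  have hcheb := meas_ge_le_variance_div_sq (memLp_finsetSum' S fun j _ => hζL j)
    (c := d * S.card / 2) (by positivity)
  rw [hmean] at hcheb
  have hset : {ξ : ℕ → Bool × Bool × Bool |
      d ≤ |2 * freq S (fun j => (ξ j).1 && (ξ j).2.2) - ε|} =
      {ξ | d * S.card / 2 ≤ |(∑ j ∈ S, ζ j) ξ - S.card * (ε / 2)|} := by
    ext ξ
    simp only [Set.mem_ofPred_eq, Finset.sum_apply]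
    have e : 2 * freq S (fun j => (ξ j).1 && (ξ j).2.2) - ε =
        (∑ j ∈ S, ζ j ξ - S.card * (ε / 2)) * (2 / S.card) := by
      simp only [freq, ζ, f]
      field_simp
    rw [e, abs_mul, abs_of_pos (by positivity : (0 : ℝ) < 2 / S.card), mul_div_assoc',
      le_div_iff₀ hc, div_le_iff₀ two_pos]
  rw [hset, measureReal_def]
  refine (ENNReal.toReal_mono ENNReal.ofReal_ne_top hcheb).trans ?_
  rw [ENNReal.toReal_ofReal (div_nonneg (variance_nonneg _ _) (sq_nonneg _)),
    div_le_div_iff₀ (by positivity) (by positivity)]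
  calc variance (∑ j ∈ S, ζ j) (noise ε) * (d ^ 2 * S.card)
      ≤ S.card / 2 * (d ^ 2 * S.card) := by gcongr
    _ = 2 * (d * S.card / 2) ^ 2 := by ring

theorem freq_mem_Icc (S : Finset ℕ) (z : ℕ → Bool) : freq S z ∈ Set.Icc (0 : ℝ) 1 := by
  have h0 : ∀ j ∈ S, (0 : ℝ) ≤ if z j = true then 1 else 0 := fun j _ => by split_ifs <;> simp
  refine ⟨div_nonneg (Finset.sum_nonneg h0) (Nat.cast_nonneg _), ?_⟩
  refine div_le_one_of_le₀ ?_ (Nat.cast_nonneg _)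
  have := Finset.sum_le_card_nsmul S (fun j => if z j = true then (1 : ℝ) else 0) 1
    fun j _ => by split_ifs <;> simp
  simpa using this

/-! ### The families `I` and `E` -/

/-- The distance scale at cell `i`. -/
def scale (i : ℕ) : ℝ := 1 / ((i : ℝ) + 1)

theorem scale_pos (i : ℕ) : 0 < scale i := by unfold scale; positivity

/-- The points of `[0, 1]` at distance at least `scale i` from the complement of `O`. -/
def resetWindow (O : Set unitInterval) (i : ℕ) : Set ℝ :=
  {r | r ∈ Set.Icc (0 : ℝ) 1 ∧ ∀ e : unitInterval, e ∉ O → scale i ≤ |r - e|}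

/-- Enough cells for the frequency to concentrate at the scale of cell `i`. -/
def resetCells (n i : ℕ) : Finset ℕ :=
  Finset.range (⌈2 / (scale i ^ 2 * weight n i)⌉₊ + 1)

theorem resetCells_nonempty (n i : ℕ) : (resetCells n i).Nonempty := by simp [resetCells]

theorem noise_real_resetCells_le (n i : ℕ) (ε : unitInterval)
    {B : Set (ℕ → Bool × Bool × Bool)} (hB : ∀ ξ ∈ B,
      scale i ≤ |2 * freq (resetCells n i) (fun j => (ξ j).1 && (ξ j).2.2) - ε|) :
    (noise ε).real B ≤ weight n i := by
  refine (measureReal_mono hB).trans ?_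
  refine (noise_real_deviation_le ε (resetCells_nonempty n i) (scale_pos i)).trans ?_
  have hs := scale_pos i
  have hw := weight_pos n i
  have hc : 2 / (scale i ^ 2 * weight n i) ≤ (resetCells n i).card := by
    rw [resetCells, Finset.card_range]
    push_cast
    linarith [Nat.le_ceil (2 / (scale i ^ 2 * weight n i))]
  have hpos : (0 : ℝ) < (resetCells n i).card := by exact_mod_cast (resetCells_nonempty n i).card_pos
  rw [div_le_iff₀ (by positivity)] at hc ⊢
  linarith

theorem noise_real_resets_le (n : ℕ) (O : Set unitInterval) {ε : unitInterval} (hε : ε ∉ O)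
    (i : ℕ) :
    (noise ε).real {ξ | Resets (resetWindow O) (resetCells n) i ξ} ≤ weight n i :=
  noise_real_resetCells_le n i ε fun _ hξ => hξ.2 ε hε

theorem eventually_noise_real_not_resets_le (n : ℕ) {O : Set unitInterval} (hO : IsOpen O)
    {ε : unitInterval} (hε : ε ∈ O) (h1 : (ε : ℝ) < 1) :
    ∃ i₀, ∀ i ≥ i₀,
      (noise ε).real {ξ | Resets (resetWindow O) (resetCells n) i ξ}ᶜ ≤ weight n i := by
  obtain ⟨ρ, hρ, hball⟩ := Metric.isOpen_iff.1 hO ε hε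
  -- The bound `ρ / 2` keeps the estimate farther than `scale i` from the complement of `O`; the
  -- bound `1 - ε` keeps it below `1`, as membership in the window requires.
  obtain ⟨i₀, hi₀⟩ := exists_nat_one_div_lt (show (0 : ℝ) < min (ρ / 2) (1 - ε) from
    lt_min (half_pos hρ) (by linarith))
  refine ⟨i₀, fun i hi => noise_real_resetCells_le n i ε fun ξ hξ => ?_⟩
  have hsc : scale i < min (ρ / 2) (1 - ε) := by
    refine lt_of_le_of_lt ?_ hi₀
    unfold scale
    gcongr
  obtain ⟨hs1, hs2⟩ := lt_min_iff.1 hsc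
  by_contra! hlt
  apply hξ
  set r := 2 * freq (resetCells n i) (fun j => (ξ j).1 && (ξ j).2.2) with hr
  have hr0 : 0 ≤ r := mul_nonneg two_pos.le (freq_mem_Icc _ _).1
  refine ⟨⟨hr0, by linarith [(abs_lt.1 hlt).2]⟩, fun e he => ?_⟩
  have hde : ρ ≤ |(e : ℝ) - ε| := by
    by_contra! hc
    exact he (hball (by rwa [Metric.mem_ball, Subtype.dist_eq, Real.dist_eq]))
  have htri := abs_sub_le (e : ℝ) r ε
  rw [abs_sub_comm (e : ℝ) r] at htri
  linarith

/-! ### Oscillation of the noisy majority operator -/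

theorem BddMeas.add {X : Type*} [MeasurableSpace X] {f g : X → ℝ} (hf : BddMeas f)
    (hg : BddMeas g) : BddMeas fun x => f x + g x := by
  obtain ⟨hfm, C, hC⟩ := hf
  obtain ⟨hgm, D, hD⟩ := hg
  exact ⟨hfm.add hgm, C + D, fun x => (abs_add_le _ _).trans (add_le_add (hC x) (hD x))⟩

theorem BddMeas.neg {X : Type*} [MeasurableSpace X] {f : X → ℝ} (hf : BddMeas f) :
    BddMeas fun x => -f x := by
  obtain ⟨hfm, C, hC⟩ := hf
  exact ⟨hfm.neg, C, fun x => by rw [abs_neg]; exact hC x⟩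

section

variable (n : ℕ) (ε : unitInterval)

theorem BddMeas.iterate_majOp {G : (ℕ → Bool) → ℝ} (hG : BddMeas G) (s : ℕ) :
    BddMeas ((NoisyMajority.majOp n ε)^[s] G) := by
  induction s with
  | zero => exact hG
  | succ s ih => rw [Function.iterate_succ_apply']; exact ih.majOp n ε

theorem iterate_majOp_add {G H : (ℕ → Bool) → ℝ} (hG : BddMeas G) (hH : BddMeas H) (s : ℕ) :
    (majOp n ε)^[s] (fun u => G u + H u) =
      fun u => (majOp n ε)^[s] G u + (majOp n ε)^[s] H u := by
  induction s with
  | zero => rfl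
  | succ s ih =>
    simp only [Function.iterate_succ_apply', ih]
    ext u
    exact integral_add (((hG.iterate_majOp n ε s).comp_maj n).integrable _)
      (((hH.iterate_majOp n ε s).comp_maj n).integrable _)

theorem iterate_majOp_neg (G : (ℕ → Bool) → ℝ) (s : ℕ) :
    (majOp n ε)^[s] (fun u => -G u) = fun u => -(majOp n ε)^[s] G u := by
  induction s with
  | zero => rfl
  | succ s ih =>
    simp only [Function.iterate_succ_apply', ih]
    ext u
    exact integral_neg _

theorem majStep_mono {u v : ℕ → Bool} (h : u ≤ v) (ξ : ℕ → Bool × Bool × Bool) :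
    majStep n u ξ ≤ majStep n v ξ := by
  intro i
  have hl : ∀ j, firstLayer (noisyCopy u ξ) j ≤ firstLayer (noisyCopy v ξ) j := fun j => by
    rw [firstLayer_noisyCopy, firstLayer_noisyCopy]
    split_ifs
    · exact le_rfl
    · exact h j
  simp only [majStep, maj, ContinuousMap.coe_mk, blockMaj]
  rw [Bool.le_iff_imp, decide_eq_true_iff, decide_eq_true_iff]
  refine fun hn => hn.trans (Finset.card_le_card (Finset.monotone_filter_right _ ?_))
  exact fun j _ hj => Bool.le_iff_imp.1 (hl j) hj

theorem monotone_iterate_majOp {G : (ℕ → Bool) → ℝ} (hG : BddMeas G) (hm : Monotone G) (s : ℕ) :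
    Monotone ((majOp n ε)^[s] G) := by
  induction s with
  | zero => exact hm
  | succ s ih =>
    intro u v huv
    have hb := hG.iterate_majOp n ε s
    rw [Function.iterate_succ_apply', majOp_eq n ε hb, majOp_eq n ε hb]
    exact integral_mono ((bddMeas_comp hb (measurable_majStep n u)).integrable _)
      ((bddMeas_comp hb (measurable_majStep n v)).integrable _) fun ξ => ih (majStep_mono n huv ξ)

/-- The indicator function of the symbol `1` at cell `i`. -/
def cellOne (i : ℕ) (u : ℕ → Bool) : ℝ := if u i = true then 1 else 0

theorem isLocal_cellOne (i : ℕ) : IsLocal {i} (cellOne i) := by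
  refine ⟨fun u v h => ?_, fun u => ?_⟩
  · simp only [cellOne, h i (by simp)]
  · simp only [cellOne]; split_ifs <;> simp

theorem monotone_cellOne (i : ℕ) : Monotone (cellOne i) := fun u v h => by
  have := Bool.le_iff_imp.1 (h i)
  simp only [cellOne]
  split_ifs <;> simp_all

theorem integral_cellOne (p : unitInterval) (i : ℕ) : ∫ u, cellOne i u ∂(berProd p) = p :=
  berProd_real_true p i

/-- The number of symbols `1` over the cells of `U`. -/
def countOne (U : Finset ℕ) (u : ℕ → Bool) : ℝ := ∑ i ∈ U, cellOne i u

theorem monotone_countOne (U : Finset ℕ) : Monotone (countOne U) :=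
  fun _ _ h => Finset.sum_le_sum fun i _ => monotone_cellOne i h

theorem bddMeas_countOne (U : Finset ℕ) : BddMeas (countOne U) := by
  refine bddMeas_of_dependsOn (U := U) fun u v h => Finset.sum_congr rfl fun i hi => ?_
  simp only [cellOne, h i hi]

theorem integral_countOne (U : Finset ℕ) (p : unitInterval) :
    ∫ u, countOne U u ∂(berProd p) = U.card * p := by
  simp only [countOne]
  rw [integral_finsetSum _ fun i _ => (isLocal_cellOne i).bddMeas.integrable _]
  simp [integral_cellOne]

/-- A bounded local function becomes monotone when the number of ones is added to it. -/
theorem monotone_countOne_add {U : Finset ℕ} {G : (ℕ → Bool) → ℝ} (hG : DependsOn G (U : Set ℕ))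
    (h1 : ∀ u v, |G u - G v| ≤ 1) : Monotone fun u => countOne U u + G u := by
  intro u v huv
  by_cases h : ∃ i ∈ U, u i ≠ v i
  · obtain ⟨i, hi, hne⟩ := h
    have hle := huv i
    have hi' : cellOne i u + 1 ≤ cellOne i v := by
      have huvi : u i = false ∧ v i = true :=
        (by decide : ∀ a b : Bool, a ≠ b → a ≤ b → a = false ∧ b = true) _ _ hne hle
      simp [cellOne, huvi]
    have hrest : ∑ j ∈ U.erase i, cellOne j u ≤ ∑ j ∈ U.erase i, cellOne j v :=
      Finset.sum_le_sum fun j _ => monotone_cellOne j huv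
    have hsplit : ∀ w : ℕ → Bool, countOne U w = cellOne i w + ∑ j ∈ U.erase i, cellOne j w :=
      fun w => (Finset.add_sum_erase U (fun j => cellOne j w) hi).symm
    have := (abs_le.1 (h1 u v)).2
    simp only [hsplit]
    linarith
  · push Not at h
    have : G u = G v := hG h
    simp only [this]
    linarith [monotone_countOne U huv]

theorem iterate_majOp_const_true {G : (ℕ → Bool) → ℝ} (hG : BddMeas G) (s : ℕ) :
    (majOp n ε)^[s] G (fun _ => true) = ∫ u, G u ∂(berProd ((meanI n ε)^[s] 1)) := by
  rw [← integral_iterate_majOp n ε 1 hG, berProd_one]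
  exact (integral_dirac' _ _ (hG.iterate_majOp n ε s).1.stronglyMeasurable).symm

theorem iterate_majOp_const_false {G : (ℕ → Bool) → ℝ} (hG : BddMeas G) (s : ℕ) :
    (majOp n ε)^[s] G (fun _ => false) = ∫ u, G u ∂(berProd ((meanI n ε)^[s] 0)) := by
  rw [← integral_iterate_majOp n ε 0 hG, berProd_zero]
  exact (integral_dirac' _ _ (hG.iterate_majOp n ε s).1.stronglyMeasurable).symm

/-- Both `countOne U + G` and `countOne U - G` are monotone and remain so under iteration. Hence the
iterate of `G` at any configuration differs from its value at all ones by at most the gap of the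
iterated count between all ones and all zeros, which the mean-field orbits give. The factor `2` is
the triangle inequality through all ones. -/
theorem abs_iterate_majOp_sub_le {U : Finset ℕ} {G : (ℕ → Bool) → ℝ} (hG : IsLocal U G) (s : ℕ)
    (u v : ℕ → Bool) : |(majOp n ε)^[s] G u - (majOp n ε)^[s] G v| ≤
      2 * (U.card * (1 - 2 * (meanField n ε)^[s] 0)) := by
  have hc := bddMeas_countOne U
  have hplus := monotone_iterate_majOp n ε (hc.add hG.bddMeas)
    (monotone_countOne_add hG.1 hG.abs_sub_le) s
  have hminus := monotone_iterate_majOp n ε (hc.add hG.bddMeas.neg)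
    (monotone_countOne_add (G := fun u => -G u) (fun _ _ h => by simp only [hG.1 h])
      fun u v => by rw [neg_sub_neg]; exact hG.abs_sub_le v u) s
  have hcount := monotone_iterate_majOp n ε hc (monotone_countOne U) s
  rw [iterate_majOp_add n ε hc hG.bddMeas] at hplus
  rw [iterate_majOp_add n ε hc hG.bddMeas.neg, iterate_majOp_neg] at hminus
  have htop : (majOp n ε)^[s] (countOne U) (fun _ => true) -
      (majOp n ε)^[s] (countOne U) (fun _ => false) =
      U.card * (1 - 2 * (meanField n ε)^[s] 0) := by
    rw [iterate_majOp_const_true n ε hc, iterate_majOp_const_false n ε hc, integral_countOne,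
      integral_countOne, coe_iterate_meanI, coe_iterate_meanI]
    simp only [Set.Icc.coe_one, Set.Icc.coe_zero, iterate_meanField_one]
    ring
  have hone : ∀ w : ℕ → Bool, |(majOp n ε)^[s] G w - (majOp n ε)^[s] G fun _ => true| ≤
      U.card * (1 - 2 * (meanField n ε)^[s] 0) := by
    intro w
    have hw : w ≤ fun _ => true := fun i => Bool.le_true _
    have hw' : (fun _ => false) ≤ w := fun i => Bool.false_le _
    have h1 := hplus hw
    have h2 := hminus hw
    have h3 := hcount hw'
    simp only at h1 h2
    rw [abs_le]
    constructor <;> linarith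
  have := abs_sub_le ((majOp n ε)^[s] G u) ((majOp n ε)^[s] G fun _ => true)
    ((majOp n ε)^[s] G v)
  have hu := hone u
  have hv := hone v
  rw [abs_sub_comm] at hv
  linarith

/-- The oscillations of the iterates of `G` under `S` vanish. -/
def OscVanishes {X : Type*} (S : (X → ℝ) → X → ℝ) (G : X → ℝ) : Prop :=
  ∀ η > 0, ∃ t₀, ∀ t ≥ t₀, ∀ x y, |S^[t] G x - S^[t] G y| ≤ η

variable {n ε}

theorem oscVanishes_majOp (h : NoLowFixedPoint n ε) {U : Finset ℕ} {G : (ℕ → Bool) → ℝ}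
    (hG : IsLocal U G) : OscVanishes (majOp n ε) G := by
  intro η hη
  have hlim := tendsto_iterate_meanField_zero n ε.2 h
  have hlim' : Tendsto (fun s => 2 * (U.card * (1 - 2 * (meanField n ε)^[s] 0))) atTop (𝓝 0) := by
    have := ((hlim.const_mul 2).const_sub 1 |>.const_mul (U.card : ℝ)).const_mul 2
    simpa using this
  obtain ⟨t₀, ht₀⟩ := (hlim'.eventually (gt_mem_nhds hη)).exists_forall_of_atTop
  exact ⟨t₀, fun t ht u v => (abs_iterate_majOp_sub_le n ε hG t u v).trans (ht₀ t ht).le⟩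

theorem tendsto_totalWeight (U : Finset ℕ) :
    Tendsto (fun k => totalWeight n ((children n)^[k] U)) atTop (𝓝 0) := by
  refine squeeze_zero (fun k => Finset.sum_nonneg fun i _ => (weight_pos n i).le)
    (totalWeight_iterate_children_le n U) ?_
  simpa using (tendsto_pow_atTop_nhds_zero_of_lt_one (r := (1 / 2 : ℝ)) (by norm_num)
    (by norm_num)).const_mul (totalWeight n U)

variable {I : ℕ → Set ℝ} {E : ℕ → Finset ℕ}

/-- Rare resets do not destroy the loss of memory of the noisy majority map. -/
theorem oscVanishes_auxOp_of_noLowFixedPoint (h : NoLowFixedPoint n ε)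
    (hr : ∀ i, (noise ε).real {ξ | Resets I E i ξ} ≤ weight n i)
    {U : Finset ℕ} {G : (ℕ → Bool) → ℝ} (hG : IsLocal U G) :
    OscVanishes (auxOp n I E ε) G := by
  intro η hη
  -- After `k` steps the remaining function lives on light cells: each of the two comparisons costs
  -- at most `η / 4`, which leaves `η / 2` for the oscillation of `majOp`.
  obtain ⟨k, hk⟩ := ((tendsto_totalWeight (n := n) U).eventually
    (gt_mem_nhds (show (0 : ℝ) < η / 8 by positivity))).exists
  have hH := hG.iterate_auxOp n I E ε k
  obtain ⟨s₀, hs₀⟩ := oscVanishes_majOp h hH (η / 2) (half_pos hη)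
  refine ⟨s₀ + k, fun t ht u v => ?_⟩
  obtain ⟨s, rfl⟩ : ∃ s, t = s + k := ⟨t - k, by omega⟩
  rw [Function.iterate_add_apply]
  have h1 := abs_le.1 (abs_iterate_auxOp_sub_iterate_majOp_le n I E ε hr s hH u)
  have h2 := abs_le.1 (abs_iterate_auxOp_sub_iterate_majOp_le n I E ε hr s hH v)
  have h3 := abs_le.1 (hs₀ s (by omega) u v)
  rw [abs_le]
  constructor <;> linarith

/-- By the offset in `block`, each generation moves at least one cell to the right, so every cell
eventually lies beyond any given `i₀`. -/
theorem le_of_mem_iterate_children (k : ℕ) (U : Finset ℕ) : ∀ i ∈ (children n)^[k] U, k ≤ i := by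
  induction k with
  | zero => simp
  | succ k ih =>
    intro i hi
    rw [Function.iterate_succ_apply', children, Finset.mem_biUnion] at hi
    obtain ⟨j, hj, hij⟩ := hi
    rw [block, Finset.mem_Icc] at hij
    have := ih j hj
    nlinarith [hij.1]

/-- If far cells are almost always reset, all memory is lost. -/
theorem oscVanishes_auxOp_of_resets {i₀ : ℕ}
    (hr : ∀ i ≥ i₀, (noise ε).real {ξ | Resets I E i ξ}ᶜ ≤ weight n i)
    {U : Finset ℕ} {G : (ℕ → Bool) → ℝ} (hG : IsLocal U G) :
    OscVanishes (auxOp n I E ε) G := by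
  intro η hη
  obtain ⟨k₀, hk₀⟩ := ((tendsto_totalWeight (n := n) U).eventually
    (gt_mem_nhds (half_pos hη))).exists_forall_of_atTop
  refine ⟨max k₀ i₀ + 1, fun t ht u v => ?_⟩
  obtain ⟨k, rfl⟩ : ∃ k, t = k + 1 := ⟨t - 1, by omega⟩
  have hH := hG.iterate_auxOp n I E ε k
  have hk := hk₀ k (by omega)
  have hb : ∀ w, |auxOp n I E ε ((auxOp n I E ε)^[k] G) w -
      (auxOp n I E ε)^[k] G fun _ => false| ≤ totalWeight n ((children n)^[k] U) := fun w =>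
    (abs_auxOp_sub_const_le n I E ε hH w).trans (Finset.sum_le_sum fun i hi =>
      hr i (by have := le_of_mem_iterate_children (n := n) k U i hi; omega))
  rw [Function.iterate_succ_apply']
  have h1 := abs_le.1 (hb u)
  have h2 := abs_le.1 (hb v)
  rw [abs_le]
  constructor <;> linarith

end

/-! ### From operators on the first layer to the Markov kernels -/

section

variable (n : ℕ) (I : ℕ → Set ℝ) (E : ℕ → Finset ℕ) (ε : unitInterval)

theorem dependsOn_cylInd {A : Type*} (U : Finset ℕ) (ω : ℕ → A) :
    DependsOn (cylInd U ω) (U : Set ℕ) := fun x y h =>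
  Finset.prod_congr rfl fun i hi => by rw [h i hi]

theorem isLocal_cylInd {A : Type*} (U : Finset ℕ) (ω : ℕ → A) : IsLocal U (cylInd U ω) := by
  classical
  refine ⟨dependsOn_cylInd U ω, fun x => ⟨Finset.prod_nonneg fun i _ => ?_,
    Finset.prod_le_one (fun i _ => ?_) fun i _ => ?_⟩⟩ <;> split_ifs <;> simp

theorem perturbation_majAux (x : ℕ → Bool × Bool) :
    perturbation (majAux n I E) ε x = (noise ε).map (noisyCopy (preImage n I E x)) := by
  rw [map_noisyCopy, perturbation_apply]
  congr 1
  ext1 i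
  congr 1
  simp only [preImage, firstLayer, majAux, ContinuousMap.coe_mk]
  split_ifs <;> rfl

theorem markovOp_majAux {g : (ℕ → Bool × Bool) → ℝ} (hg : BddMeas g) (x : ℕ → Bool × Bool) :
    markovOp (majAux n I E) ε g x = ∫ ξ, g (noisyCopy (preImage n I E x) ξ) ∂(noise ε) := by
  rw [markovOp, perturbation_majAux, integral_map (measurable_noisyCopy _).aemeasurable
    hg.1.aestronglyMeasurable]

/-- The kernel sees a configuration only through `preImage`, since the second layer of the image is
`0`; this intertwines the kernel with `auxOp`. -/
theorem iterate_markovOp_comp_preImage {U : Finset ℕ} {G : (ℕ → Bool) → ℝ} (hG : IsLocal U G)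
    (t : ℕ) : (markovOp (majAux n I E) ε)^[t] (fun x => G (preImage n I E x)) =
      fun x => (auxOp n I E ε)^[t] G (preImage n I E x) := by
  induction t with
  | zero => rfl
  | succ t ih =>
    rw [Function.iterate_succ_apply', Function.iterate_succ_apply', ih]
    ext x
    exact markovOp_majAux n I E ε (bddMeas_comp (hG.iterate_auxOp n I E ε t).bddMeas
      (measurable_preImage n I E)) x

variable {n I E ε}

theorem isErgodic_majAux_of_oscVanishes
    (h : ∀ (U : Finset ℕ) (G : (ℕ → Bool) → ℝ), IsLocal U G → OscVanishes (auxOp n I E ε) G) :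
    IsErgodic (majAux n I E) ε := by
  refine isErgodic_of_oscillation _ _ fun U ω η hη => ?_
  have hc := isLocal_cylInd U ω
  -- One kernel step averages the noise out of the cylinder function and leaves `R`, a local
  -- function of the first layer of the image.
  let R : (ℕ → Bool) → ℝ := fun u => ∫ ξ, cylInd U ω (noisyCopy u ξ) ∂(noise ε)
  have hR : IsLocal U R := by
    refine ⟨fun u v huv => integral_congr_ae (ae_of_all _ fun ξ => hc.1 fun i hi => ?_),
      fun u => integral_mem_Icc _ (bddMeas_comp hc.bddMeas (measurable_noisyCopy u))
        fun ξ => hc.2 _⟩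
    simp only [noisyCopy, huv i hi]
  have hstep : markovOp (majAux n I E) ε (cylInd U ω) = fun x => R (preImage n I E x) :=
    funext (markovOp_majAux n I E ε hc.bddMeas)
  obtain ⟨t₀, ht₀⟩ := h U R hR η hη
  refine ⟨t₀ + 1, fun t ht x y => ?_⟩
  obtain ⟨s, rfl⟩ : ∃ s, t = s + 1 := ⟨t - 1, by omega⟩
  rw [Function.iterate_succ_apply, hstep, iterate_markovOp_comp_preImage n I E ε hR]
  exact ht₀ s (by omega) _ _

theorem iterate_markovOp_maj {g : (ℕ → Bool) → ℝ} (t : ℕ) :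
    (markovOp (maj n) ε)^[t + 1] g =
      fun x => (majOp n ε)^[t] (markovOp (ContinuousMap.id _) ε g) (maj n x) := by
  induction t with
  | zero => rfl
  | succ t ih =>
    rw [Function.iterate_succ_apply', ih, Function.iterate_succ_apply']
    rfl

theorem isErgodic_maj_of_noLowFixedPoint (h : NoLowFixedPoint n ε) : IsErgodic (maj n) ε := by
  refine isErgodic_of_oscillation _ _ fun U ω η hη => ?_
  have hc := isLocal_cylInd U ω
  have hR : IsLocal U (markovOp (ContinuousMap.id _) ε (cylInd U ω)) := by
    have e : markovOp (ContinuousMap.id _) ε (cylInd U ω) =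
        fun u => ∫ ξ, cylInd U ω (firstLayer (noisyCopy u ξ)) ∂(noise ε) := by
      ext u
      rw [markovOp, ← map_firstLayer_noisyCopy, integral_map
        (φ := fun ξ => firstLayer (noisyCopy u ξ)) (measurable_firstLayer.comp (measurable_noisyCopy u)).aemeasurable
        hc.bddMeas.1.aestronglyMeasurable]
    rw [e]
    refine ⟨fun u v huv => integral_congr_ae (ae_of_all _ fun ξ => hc.1 fun i hi => ?_),
      fun u => integral_mem_Icc _ (bddMeas_comp hc.bddMeas
        (measurable_firstLayer.comp (measurable_noisyCopy u))) fun ξ => hc.2 _⟩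
    rw [firstLayer_noisyCopy, firstLayer_noisyCopy, huv i hi]
  obtain ⟨t₀, ht₀⟩ := oscVanishes_majOp h hR η hη
  refine ⟨t₀ + 1, fun t ht x y => ?_⟩
  obtain ⟨s, rfl⟩ : ∃ s, t = s + 1 := ⟨t - 1, by omega⟩
  rw [iterate_markovOp_maj]
  exact ht₀ s (by omega) _ _

/-! ### Identification of the threshold with the absence of low fixed points -/

theorem mem_uni_maj_iff (h1 : (ε : ℝ) < 1) : ε ∈ uni (maj n) ↔ NoLowFixedPoint n ε :=
  ⟨noLowFixedPoint_of_mem_uni h1,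
    fun h => erg_subset_uni _ (isErgodic_maj_of_noLowFixedPoint h)⟩

theorem threshold_eq (n : ℕ) :
    threshold n = sInf {r : ℝ | r ∈ Set.Ico (0 : ℝ) 1 ∧ NoLowFixedPoint n r} := by
  rw [threshold]
  congr 1
  ext r
  constructor
  · rintro ⟨ε, hε, h1, rfl⟩
    exact ⟨⟨ε.2.1, h1⟩, (mem_uni_maj_iff h1).1 hε⟩
  · rintro ⟨⟨h0, h1⟩, h⟩
    exact ⟨⟨r, h0, h1.le⟩, (mem_uni_maj_iff h1).2 h, h1, rfl⟩

theorem noLowFixedPoint_of_threshold_le (hn : 1 ≤ n) (h : threshold n ≤ ε) :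
    NoLowFixedPoint n ε :=
  noLowFixedPoint_of_sInf_le hn ε.2 (by rwa [← threshold_eq])

theorem threshold_le_of_noLowFixedPoint (h : NoLowFixedPoint n ε) : threshold n ≤ ε := by
  rw [threshold_eq]
  have hbdd : BddBelow {r : ℝ | r ∈ Set.Ico (0 : ℝ) 1 ∧ NoLowFixedPoint n r} :=
    ⟨0, fun r hr => hr.1.1⟩
  rcases ε.2.2.lt_or_eq with h1 | h1
  · exact csInf_le hbdd ⟨⟨ε.2.1, h1⟩, h⟩
  -- The set defining the threshold excludes `1`, so at `ε = 1` another element bounds the infimum.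
  · obtain ⟨r, hr, hfix⟩ := exists_noLowFixedPoint n
    exact (csInf_le hbdd ⟨hr, hfix⟩).trans (by rw [h1]; exact hr.2.le)

theorem iterate_meanField_zero_le {r : ℝ} (hr : r ∈ Set.Icc (0 : ℝ) 1)
    (hfix : meanField n ε r = r) (s : ℕ) : (meanField n ε)^[s] 0 ≤ r := by
  have h : (meanField n ε)^[s] 0 ∈ Set.Icc 0 r := by
    induction s with
    | zero => exact ⟨le_rfl, hr.1⟩
    | succ s ih =>
      have hs : (meanField n ε)^[s] 0 ∈ Set.Icc (0 : ℝ) 1 := ⟨ih.1, ih.2.trans hr.2⟩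
      rw [Function.iterate_succ_apply']
      refine ⟨(meanField_mem_Icc n ε.2 hs).1, ?_⟩
      rw [← hfix]
      exact monotoneOn_meanField n ε.2 hs hr ih.2
  exact h.2

/-- A lower bound on the iterates of `auxOp` from a constant configuration yields an invariant
measure. -/
theorem exists_invariant_majAux {U : Finset ℕ} {G : (ℕ → Bool) → ℝ} (hG : IsLocal U G) (b : Bool)
    {c : ℝ} (hc : ∀ t, c ≤ (auxOp n I E ε)^[t] G fun _ => b) :
    ∃ π ∈ invariantMeasures (majAux n I E) ε, c ≤ ∫ x, G (preImage n I E x) ∂π := by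
  have hb := bddMeas_comp hG.bddMeas (measurable_preImage n I E)
  have hν : IsProbabilityMeasure ((noise ε).map (noisyCopy fun _ => b)) :=
    Measure.isProbabilityMeasure_map (measurable_noisyCopy _).aemeasurable
  refine exists_invariant_le_integral _ ε ((noise ε).map (noisyCopy fun _ => b)) hb ?_ c fun t => ?_
  · have hpre : Continuous (preImage n I E) :=
      continuous_pi fun i => continuous_fst.comp
        ((continuous_apply i).comp (majAux n I E).continuous)
    obtain ⟨g, hg⟩ := dependsOn_iff_exists_comp.1 hG.1
    have : Finite ((i : (U : Set ℕ)) → Bool) := Pi.finite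
    have hGc : Continuous G := by
      rw [hg]
      exact continuous_of_discreteTopology.comp (continuous_pi fun i => continuous_apply _)
    exact hGc.comp hpre
  · rw [iterate_markovOp_comp_preImage n I E ε hG, integral_map
      (measurable_noisyCopy _).aemeasurable (bddMeas_comp (hG.iterate_auxOp n I E ε t).bddMeas
        (measurable_preImage n I E)).1.aestronglyMeasurable]
    -- The initial law is already a noisy copy of the constant, so `t` kernel steps followed by
    -- `preImage` make `t + 1` steps of `auxOp`.
    have := hc (t + 1)
    rwa [Function.iterate_succ_apply'] at this

theorem iterate_auxOp_one_sub {U : Finset ℕ} {G : (ℕ → Bool) → ℝ} (hG : IsLocal U G) (t : ℕ) :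
    (auxOp n I E ε)^[t] (fun u => 1 - G u) = fun u => 1 - (auxOp n I E ε)^[t] G u := by
  induction t with
  | zero => rfl
  | succ t ih =>
    rw [Function.iterate_succ_apply', Function.iterate_succ_apply', ih]
    ext u
    have := (bddMeas_comp (hG.iterate_auxOp n I E ε t).bddMeas
      (measurable_auxStep n I E u)).integrable (noise ε)
    rw [auxOp, integral_sub (integrable_const _) this]
    simp [auxOp]

theorem tendsto_weight (n : ℕ) : Tendsto (weight n) atTop (𝓝 0) := by
  refine tendsto_pow_atTop_nhds_zero_of_lt_one (by positivity) ?_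
  rw [div_lt_one (by positivity)]
  have : (0 : ℝ) ≤ n := Nat.cast_nonneg n
  linarith

/-- Rare resets do not destroy the coexistence of several invariant measures. -/
theorem notMem_uni_majAux (h : ¬ NoLowFixedPoint n ε)
    (hr : ∀ i, (noise ε).real {ξ | Resets I E i ξ} ≤ weight n i) :
    ε ∉ uni (majAux n I E) := by
  rintro ⟨π, hπ⟩
  simp only [NoLowFixedPoint, not_forall, not_not] at h
  obtain ⟨r, hr1, hfix⟩ := h
  have hrI : r ∈ Set.Icc (0 : ℝ) 1 := ⟨hr1.1, by linarith [hr1.2]⟩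
  -- With this choice the lower bounds `1 - r - 2 * weight n i` obtained for `cellOne i` and for its
  -- complement add up to more than `1`, so no single law satisfies both.
  obtain ⟨i, hi⟩ := ((tendsto_weight n).eventually
    (gt_mem_nhds (show (0 : ℝ) < (1 - 2 * r) / 4 by linarith [hr1.2]))).exists
  have hG := isLocal_cellOne i
  have hG' : IsLocal {i} fun u => 1 - cellOne i u :=
    ⟨fun u v huv => by simp only [hG.1 huv], fun u => by
      obtain ⟨h0, h1⟩ := hG.2 u
      exact ⟨by linarith, by linarith⟩⟩
  have hclose : ∀ t u, |(auxOp n I E ε)^[t] (cellOne i) u - (majOp n ε)^[t] (cellOne i) u| ≤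
      2 * weight n i := fun t u => by
    simpa [totalWeight] using abs_iterate_auxOp_sub_iterate_majOp_le n I E ε hr t hG u
  obtain ⟨π₁, hπ₁, h₁⟩ := exists_invariant_majAux (n := n) (I := I) (E := E) (ε := ε) hG true
    (c := 1 - r - 2 * weight n i) fun t => by
      have h2 := abs_le.1 (hclose t fun _ => true)
      rw [iterate_majOp_const_true n ε hG.bddMeas, integral_cellOne, coe_iterate_meanI] at h2
      simp only [Set.Icc.coe_one, iterate_meanField_one] at h2
      linarith [iterate_meanField_zero_le hrI hfix t]
  obtain ⟨π₂, hπ₂, h₂⟩ := exists_invariant_majAux (n := n) (I := I) (E := E) (ε := ε) hG' false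
    (c := 1 - r - 2 * weight n i) fun t => by
      have h2 := abs_le.1 (hclose t fun _ => false)
      rw [iterate_majOp_const_false n ε hG.bddMeas, integral_cellOne, coe_iterate_meanI] at h2
      simp only [Set.Icc.coe_zero] at h2
      rw [iterate_auxOp_one_sub hG]
      linarith [iterate_meanField_zero_le hrI hfix t]
  have hprob := hπ₁.1
  rw [hπ] at hπ₁ hπ₂
  rw [Set.mem_singleton_iff] at hπ₁ hπ₂
  subst hπ₁ hπ₂
  rw [integral_sub (integrable_const _)
    ((bddMeas_comp hG.bddMeas (measurable_preImage n I E)).integrable _)] at h₂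
  simp only [integral_const, probReal_univ, smul_eq_mul, mul_one] at h₂
  linarith

/-! ### Noise level `1` and the two inclusions -/

theorem isErgodic_one {A : Type*} [Fintype A] [Nonempty A] [MeasurableSpace A]
    [MeasurableSingletonClass A] [TopologicalSpace A] [DiscreteTopology A]
    (F : C(ℕ → A, ℕ → A)) : IsErgodic F 1 := by
  refine isErgodic_of_oscillation _ _ fun U ω η hη => ⟨1, fun t ht x y => ?_⟩
  obtain ⟨s, rfl⟩ : ∃ s, t = s + 1 := ⟨t - 1, by omega⟩
  have h : perturbation F 1 x = perturbation F 1 y := by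
    rw [perturbation_apply, perturbation_apply]
    congr 1
    ext1 i
    simp [noisyCell]
  rw [Function.iterate_succ_apply', markovOp, markovOp, h, sub_self, abs_zero]
  exact hη.le

theorem subset_erg_majAux (hn : 1 ≤ n) {O : Set unitInterval} (hO : IsOpen O) :
    O ∪ {ε : unitInterval | threshold n ≤ (ε : ℝ)} ⊆
      erg (majAux n (resetWindow O) (resetCells n)) := by
  intro ε hε
  by_cases hεO : ε ∈ O
  -- At `ε = 1` the estimate may exceed `1` and leave the window, so that level is treated
  -- separately.
  · rcases ε.2.2.lt_or_eq with h1 | h1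
    · obtain ⟨i₀, hi₀⟩ := eventually_noise_real_not_resets_le n hO hεO h1
      exact isErgodic_majAux_of_oscVanishes fun U G hG => oscVanishes_auxOp_of_resets hi₀ hG
    · obtain rfl : ε = 1 := Subtype.ext h1
      exact isErgodic_one _
  · have hfix := noLowFixedPoint_of_threshold_le hn (hε.resolve_left hεO)
    exact isErgodic_majAux_of_oscVanishes fun U G hG =>
      oscVanishes_auxOp_of_noLowFixedPoint hfix (noise_real_resets_le n O hεO) hG

theorem uni_majAux_subset (n : ℕ) (O : Set unitInterval) :
    uni (majAux n (resetWindow O) (resetCells n)) ⊆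
      O ∪ {ε : unitInterval | threshold n ≤ (ε : ℝ)} := by
  intro ε hε
  by_contra hc
  rw [Set.mem_union, not_or] at hc
  exact notMem_uni_majAux (fun h => hc.2 (threshold_le_of_noLowFixedPoint h))
    (noise_real_resets_le n O hc.1) hε

end

end NoisyMajority

end

theorem mainTheorem6 (n : ℕ) (hn : 1 ≤ n) (O : Set unitInterval) (hO : IsOpen O) :
    ∃ (I : ℕ → Set ℝ) (E : ℕ → Finset ℕ),
      (∀ i, I i ⊆ Set.Icc 0 1) ∧ (∀ i, (E i).Nonempty) ∧
      NoisyMajority.uni (NoisyMajority.majAux n I E) =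
        O ∪ {ε : unitInterval | NoisyMajority.threshold n ≤ (ε : ℝ)} ∧
      NoisyMajority.erg (NoisyMajority.majAux n I E) =
        O ∪ {ε : unitInterval | NoisyMajority.threshold n ≤ (ε : ℝ)} := by
  have hErg := NoisyMajority.subset_erg_majAux hn hO
  have hUni := NoisyMajority.uni_majAux_subset n O
  have hsub := NoisyMajority.erg_subset_uni
    (NoisyMajority.majAux n (NoisyMajority.resetWindow O) (NoisyMajority.resetCells n))
  exact ⟨NoisyMajority.resetWindow O, NoisyMajority.resetCells n, fun i r hr => hr.1,
    NoisyMajority.resetCells_nonempty n, hUni.antisymm (hErg.trans hsub),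
    (hsub.trans hUni).antisymm hErg⟩
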